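/- Let $(R,\mathfrak m)$ be a local ring (commutative with a unique maximal ideal, not necessarily Noetherian) of finite embedding dimension, that is, such that $\mathfrak m$ is finitely generated. The pseudo-dimension $\mathrm{pd}(S)\in\mathbb N\cup\{\infty\}$ of a local ring $S$ is the least $d$ for which $\mathrm{pd}(S)\le d$ in the following recursive sense ($\infty$ if there is none): $\mathrm{pd}(S)\le 0$ if and only if $S$ is Artinian, and $\mathrm{pd}(S)\le d+1$ if and only if $\mathrm{pd}(S/xS)\le d$ for some non-unit $x\in S$. Then the following numbers are all finite and equal: 1. the pseudo-dimension $\mathrm{pd}(R)$ of $R$; 2. the least possible number of elements generating an $\mathfrak m$-primary ideal of $R$; 3. the Krull dimension of the $\mathfrak m$-adic completion $\widehat R=\varprojlim_n R/\mathfrak m^n$; 4. the Krull dimension of the associated graded ring $\mathrm{gr}\,R=\bigoplus_{n\ge 0}\mathfrak m^n/\mathfrak m^{n+1}$; 5. the degree of the Hilbert–Samuel polynomial $\mathrm{HS}_R$, the unique polynomial with rational coefficients such that $\mathrm{HS}_R(n)$ equals the (finite) length of $R/\mathfrak m^n$ for all large $n$ (existence and uniqueness of this polynomial are part of the claim); 6.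 the pseudo-dimension of the separated quotient $R/\bigcap_{n}\mathfrak m^n$. -/

import Mathlib

universe u

section AssociatedGraded

variable {R : Type u} [CommRing R]

/-- The `n`-th graded piece `I ^ n / I ^ (n + 1)` of the `I`-adic filtration. -/
def GrPiece (I : Ideal R) (n : ℕ) : Type u :=
  (I ^ n : Ideal R) ⧸ Submodule.submoduleOf (I ^ (n + 1)) (I ^ n)

instance GrPiece.instAddCommGroup (I : Ideal R) (n : ℕ) : AddCommGroup (GrPiece I n) :=
  inferInstanceAs
    (AddCommGroup ((I ^ n : Ideal R) ⧸ Submodule.submoduleOf (I ^ (n + 1)) (I ^ n)))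

instance GrPiece.instModule (I : Ideal R) (n : ℕ) : Module R (GrPiece I n) :=
  inferInstanceAs (Module R ((I ^ n : Ideal R) ⧸ Submodule.submoduleOf (I ^ (n + 1)) (I ^ n)))

/-- The projection `I ^ n → I ^ n / I ^ (n + 1)`. -/
def GrPiece.mk (I : Ideal R) (n : ℕ) : (I ^ n : Ideal R) →ₗ[R] GrPiece I n :=
  Submodule.mkQ (Submodule.submoduleOf (I ^ (n + 1)) (I ^ n))

theorem GrPiece.mk_surjective (I : Ideal R) (n : ℕ) : Function.Surjective (GrPiece.mk I n) :=
  Submodule.mkQ_surjective _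

theorem GrPiece.mk_eq_zero_iff (I : Ideal R) (n : ℕ) (a : (I ^ n : Ideal R)) :
    GrPiece.mk I n a = 0 ↔ (a : R) ∈ I ^ (n + 1) :=
  Submodule.Quotient.mk_eq_zero _

theorem GrPiece.mul_mem (I : Ideal R) {i j : ℕ} {a b : R} (ha : a ∈ I ^ i) (hb : b ∈ I ^ j) :
    a * b ∈ I ^ (i + j) := by
  rw [pow_add]
  exact Ideal.mul_mem_mul ha hb

/-- The bilinear map `(a, b) ↦ a * b mod I ^ (i + j + 1)` on `I ^ i × I ^ j`. -/
def GrPiece.preMul (I : Ideal R) (i j : ℕ) :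
    (I ^ i : Ideal R) →ₗ[R] (I ^ j : Ideal R) →ₗ[R] GrPiece I (i + j) :=
  LinearMap.mk₂ R
    (fun a b => GrPiece.mk I (i + j) ⟨(a : R) * (b : R), GrPiece.mul_mem I a.2 b.2⟩)
    (fun a a' b => by
      rw [← map_add]; congr 1; ext; simp [add_mul])
    (fun c a b => by
      rw [← map_smul]; congr 1; ext; simp [mul_assoc])
    (fun a b b' => by
      rw [← map_add]; congr 1; ext; simp [mul_add])
    (fun c a b => by
      rw [← map_smul]; congr 1; ext; simp [mul_left_comm])

/-- The multiplication `I ^ i / I ^ (i + 1) × I ^ j / I ^ (j + 1) → I ^ (i + j) / I ^ (i + j + 1)`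
induced by that of `R`. -/
def GrPiece.mul (I : Ideal R) (i j : ℕ) :
    GrPiece I i →ₗ[R] GrPiece I j →ₗ[R] GrPiece I (i + j) :=
  Submodule.liftQ (Submodule.submoduleOf (I ^ (i + 1)) (I ^ i))
    (LinearMap.flip
      (Submodule.liftQ (Submodule.submoduleOf (I ^ (j + 1)) (I ^ j)) (GrPiece.preMul I i j).flip
        (by
          intro b hb
          have hb' : (b : R) ∈ I ^ (j + 1) := hb
          rw [LinearMap.mem_ker]
          ext a
          exact (GrPiece.mk_eq_zero_iff I (i + j) ⟨(a : R) * (b : R), GrPiece.mul_mem I a.2 b.2⟩).2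
            (GrPiece.mul_mem (i := i) (j := j + 1) I a.2 hb'))))
    (by
      intro a ha
      have ha' : (a : R) ∈ I ^ (i + 1) := ha
      rw [LinearMap.mem_ker]
      ext b
      obtain ⟨b, rfl⟩ := GrPiece.mk_surjective I j b
      refine (GrPiece.mk_eq_zero_iff I (i + j) ⟨(a : R) * (b : R), _⟩).2 ?_
      have h := GrPiece.mul_mem I ha' b.2
      rwa [Nat.add_right_comm] at h)

theorem GrPiece.mul_mk_mk (I : Ideal R) (i j : ℕ) (a : (I ^ i : Ideal R)) (b : (I ^ j : Ideal R)) :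
    GrPiece.mul I i j (GrPiece.mk I i a) (GrPiece.mk I j b) =
      GrPiece.mk I (i + j) ⟨(a : R) * (b : R), GrPiece.mul_mem I a.2 b.2⟩ :=
  rfl

theorem GrPiece.gradedMk_eq (I : Ideal R) {i j : ℕ} (h : i = j) (a : (I ^ i : Ideal R))
    (b : (I ^ j : Ideal R)) (hab : (a : R) = b) :
    GradedMonoid.mk (A := GrPiece I) i (GrPiece.mk I i a) =
      GradedMonoid.mk (A := GrPiece I) j (GrPiece.mk I j b) := by
  subst h
  rw [Subtype.ext hab]

/-- The class of `x : R` in degree zero, that is, in `I ^ 0 / I ^ 1 = R / I`. -/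
def GrPiece.ofDegreeZero (I : Ideal R) (x : R) : GrPiece I 0 :=
  GrPiece.mk I 0 ⟨x, by simp⟩

instance GrPiece.instGMul (I : Ideal R) : GradedMonoid.GMul (GrPiece I) where
  mul {i j} a b := GrPiece.mul I i j a b

instance GrPiece.instGOne (I : Ideal R) : GradedMonoid.GOne (GrPiece I) where
  one := GrPiece.ofDegreeZero I 1

instance GrPiece.instGCommRing (I : Ideal R) : DirectSum.GCommRing (GrPiece I) where
  mul_zero {i j} a := map_zero (GrPiece.mul I i j a)
  zero_mul {i j} b := LinearMap.map_zero₂ (GrPiece.mul I i j) b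
  mul_add {i j} a b c := map_add (GrPiece.mul I i j a) b c
  add_mul {i j} a b c := LinearMap.map_add₂ (GrPiece.mul I i j) a b c
  one_mul := by
    rintro ⟨i, a⟩
    obtain ⟨a, rfl⟩ := GrPiece.mk_surjective I i a
    exact GrPiece.gradedMk_eq I (Nat.zero_add i) _ a (_root_.one_mul (a : R))
  mul_one := by
    rintro ⟨i, a⟩
    obtain ⟨a, rfl⟩ := GrPiece.mk_surjective I i a
    exact GrPiece.gradedMk_eq I (Nat.add_zero i) _ a (_root_.mul_one (a : R))
  mul_assoc := by
    rintro ⟨i, a⟩ ⟨j, b⟩ ⟨k, c⟩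
    obtain ⟨a, rfl⟩ := GrPiece.mk_surjective I i a
    obtain ⟨b, rfl⟩ := GrPiece.mk_surjective I j b
    obtain ⟨c, rfl⟩ := GrPiece.mk_surjective I k c
    exact GrPiece.gradedMk_eq I (Nat.add_assoc i j k) _ _ (_root_.mul_assoc (a : R) b c)
  mul_comm := by
    rintro ⟨i, a⟩ ⟨j, b⟩
    obtain ⟨a, rfl⟩ := GrPiece.mk_surjective I i a
    obtain ⟨b, rfl⟩ := GrPiece.mk_surjective I j b
    exact GrPiece.gradedMk_eq I (Nat.add_comm i j) _ _ (_root_.mul_comm (a : R) b)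
  natCast n := GrPiece.ofDegreeZero I n
  natCast_zero := by
    refine (GrPiece.mk_eq_zero_iff I 0 _).2 ?_
    simp
  natCast_succ n := by
    unfold GrPiece.ofDegreeZero
    refine Eq.trans ?_ (map_add (GrPiece.mk I 0) _ _)
    congr 1
    ext
    simp
  intCast n := GrPiece.ofDegreeZero I n
  intCast_ofNat n := by simp
  intCast_negSucc_ofNat n := by
    unfold GrPiece.ofDegreeZero
    rw [← map_neg]
    congr 1
    ext
    simp

/-- The associated graded ring `gr_I R = ⨁ n, I ^ n / I ^ (n + 1)`. -/
abbrev AssociatedGradedRing (I : Ideal R) : Type u :=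
  DirectSum ℕ (GrPiece I)

end AssociatedGraded

/-- `PseudoDimLE d R` says that the pseudo-dimension of the local ring `R` is at most `d`: for
`d = 0` that `R` is Artinian, and for `d + 1` that `R / xR` has pseudo-dimension at most `d` for
some non-unit `x`. (In a local ring the non-units are the elements of the maximal ideal, and
`R / xR` is then again a local ring.) -/
def PseudoDimLE : ℕ → (R : Type u) → [CommRing R] → Prop
  | 0, R, _ => IsArtinianRing R
  | d + 1, R, _ => ∃ x ∈ nonunits R, PseudoDimLE d (R ⧸ Ideal.span {x})

/-- The pseudo-dimension of a local ring `R`: the least `d` such that `PseudoDimLE d R`, and `⊤`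
if there is none. -/
noncomputable def pseudoDim (R : Type u) [CommRing R] : ℕ∞ :=
  ⨅ (d : ℕ) (_ : PseudoDimLE d R), (d : ℕ∞)

/-- There is an ideal generated by `n` elements which is primary to the maximal ideal of `R`. -/
def HasPrimaryIdealGeneratedBy (R : Type u) [CommRing R] [IsLocalRing R] (n : ℕ) : Prop :=
  ∃ f : Fin n → R, (Ideal.span (Set.range f)).IsPrimary ∧
    (Ideal.span (Set.range f)).radical = IsLocalRing.maximalIdeal R

/-- `P` is a Hilbert–Samuel polynomial of the local ring `R`: for all large `n`, the `R`-module
`R / 𝔪 ^ n` has finite length and `P(n)` is equal to that length. -/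
def IsHilbertSamuelPolynomial (R : Type u) [CommRing R] [IsLocalRing R] (P : Polynomial ℚ) : Prop :=
  ∀ᶠ n : ℕ in Filter.atTop, ∃ l : ℕ,
    Module.length R (R ⧸ IsLocalRing.maximalIdeal R ^ n) = (l : ℕ∞) ∧ P.eval (n : ℚ) = (l : ℚ)

/-- The ideal of infinitesimals of a local ring: the intersection of all powers of the maximal
ideal. -/
def infinitesimals (R : Type u) [CommRing R] [IsLocalRing R] : Ideal R :=
  ⨅ n : ℕ, IsLocalRing.maximalIdeal R ^ n

/-- The separated quotient of a local ring. -/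
abbrev SeparatedQuotientRing (R : Type u) [CommRing R] [IsLocalRing R] : Type u :=
  R ⧸ infinitesimals R

/-!
# Equality of the dimensions of a local ring with finitely generated maximal ideal

Let `(R, 𝔪)` be a local ring with `𝔪` generated by `x₁, …, x_r`, and let `d` be the least number of
generators of an `𝔪`-primary ideal.

*Pseudo-dimension.* A chain of successive non-units with Artinian last quotient lifts to generators
of an `𝔪`-primary ideal and conversely, so `pd R = d`
(`pseudoDimLE_iff_hasPrimaryIdealGeneratedBy`).

*The Hilbert–Samuel polynomial.* Filter `R` by the ideals generated by the monomials in the `x i`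
that are at least `x ^ a` in the degree-lexicographic order. Each step has length at most one, and
the exponents of the steps of length one (the standard monomials) form a lower set in `ℕ ^ r`. Thus
`length (R / 𝔪 ^ n)` counts the points of degree `< n` in a lower set, and such counts are
eventually polynomial by Dickson's lemma (`eventuallyPolynomial_degreeCount`,
`length_quotient_pow_eq_sum_degreeCount`).

*Completion and separated quotient.* Both `R → R̂` and `R → R / ⋂ 𝔪 ^ n` induce isomorphisms on the
quotients by powers of the maximal ideals. By Nakayama's lemma such maps preserve `d` and the
Hilbert–Samuel function (`InducesIsoOnPowerQuotients`). The completion is Noetherian: division by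
finitely many elements of an ideal, chosen by Dickson's lemma on leading exponents, converges
(`isNoetherianRing_of_isAdicComplete`). So `dim R̂ = d` by Krull's height theorem and the existence
of systems of parameters.

*Degree of the polynomial.* Comparing `R` with `R / x` gives `deg HS_R ≤ pd R` by induction, and
`dim R̂ ≤ deg HS_{R̂} = deg HS_R` by the Artin–Rees lemma in the domain `R̂ / p` for a suitable
prime `p`. As `pd R = d = dim R̂`, the degree is `d`.

*Associated graded ring.* The space of elements of degree `≤ n` in `gr R` is the `n`-th power of the
space of elements of degree `≤ 1` and has dimension `length (R / 𝔪 ^ (n + 1))` over the residue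
field. By Noether normalization the order of growth of the powers of a generating subspace of a
finitely generated algebra is its Krull dimension (`exists_ringKrullDim_eq_and_finrank_pow_bounds`),
so `dim gr R = deg HS_R`.
-/

universe v

open Filter Polynomial IsLocalRing

/-! ### Eventually polynomial functions and lower sets of exponents -/

/-- A sequence of natural numbers agrees with a polynomial function for all large arguments. -/
def EventuallyPolynomial (f : ℕ → ℕ) : Prop :=
  ∃ P : ℚ[X], ∀ᶠ n : ℕ in atTop, P.eval (n : ℚ) = f n

theorem EventuallyPolynomial.congr {f g : ℕ → ℕ} (hf : EventuallyPolynomial f)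
    (h : ∀ᶠ n in atTop, g n = f n) : EventuallyPolynomial g := by
  obtain ⟨P, hP⟩ := hf
  refine ⟨P, ?_⟩
  filter_upwards [hP, h] with n h1 h2
  rw [h1, h2]

theorem EventuallyPolynomial.add {f g : ℕ → ℕ} (hf : EventuallyPolynomial f)
    (hg : EventuallyPolynomial g) : EventuallyPolynomial (fun n => f n + g n) := by
  obtain ⟨P, hP⟩ := hf
  obtain ⟨Q, hQ⟩ := hg
  refine ⟨P + Q, ?_⟩
  filter_upwards [hP, hQ] with n h1 h2
  simp [h1, h2]

theorem eventuallyPolynomial_zero : EventuallyPolynomial (fun _ => 0) :=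
  ⟨0, by simp⟩

theorem EventuallyPolynomial.sum {ι : Type*} (s : Finset ι) (f : ι → ℕ → ℕ)
    (hf : ∀ i ∈ s, EventuallyPolynomial (f i)) :
    EventuallyPolynomial (fun n => ∑ i ∈ s, f i n) := by
  classical
  induction s using Finset.induction_on with
  | empty => simpa using eventuallyPolynomial_zero
  | insert a s ha ih =>
    simp only [Finset.sum_insert ha]
    exact (hf a (by simp)).add (ih fun i hi => hf i (by simp [hi]))

theorem EventuallyPolynomial.shift {f : ℕ → ℕ} (hf : EventuallyPolynomial f) (j : ℕ) :
    EventuallyPolynomial (fun n => f (n - j)) := by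
  obtain ⟨P, hP⟩ := hf
  refine ⟨P.comp (X - C (j : ℚ)), ?_⟩
  filter_upwards [(tendsto_sub_atTop_nat j).eventually hP, eventually_ge_atTop j] with n h1 h2
  simp only [eval_comp, eval_sub, eval_X, eval_C]
  rw [← h1, Nat.cast_sub h2]

theorem Polynomial.exists_eval_eq_sum_range (P : ℚ[X]) :
    ∃ Q : ℚ[X], ∀ n : ℕ, Q.eval (n : ℚ) = ∑ i ∈ Finset.range n, P.eval (i : ℚ) := by
  induction P using Polynomial.induction_on' with
  | add p q hp hq =>
    obtain ⟨P, hP⟩ := hp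
    obtain ⟨Q, hQ⟩ := hq
    exact ⟨P + Q, fun n => by simp [hP, hQ, Finset.sum_add_distrib]⟩
  | monomial p a =>
    refine ⟨C a * ∑ i ∈ Finset.range (p + 1),
      C (_root_.bernoulli i * ((p + 1).choose i) / (p + 1)) * (X : ℚ[X]) ^ (p + 1 - i), fun n => ?_⟩
    simp only [eval_mul, eval_C, eval_finsetSum, eval_pow, eval_X, eval_monomial]
    rw [← Finset.mul_sum, sum_range_pow]
    congr 1
    refine Finset.sum_congr rfl fun i _ => ?_
    ring

theorem EventuallyPolynomial.sum_range {f : ℕ → ℕ} (hf : EventuallyPolynomial f) :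
    EventuallyPolynomial (fun n => ∑ i ∈ Finset.range n, f i) := by
  obtain ⟨P, hP⟩ := hf
  obtain ⟨N, hN⟩ := eventually_atTop.1 hP
  obtain ⟨Q, hQ⟩ := P.exists_eval_eq_sum_range
  refine ⟨Q + C ((∑ i ∈ Finset.range N, (f i : ℚ)) - ∑ i ∈ Finset.range N, P.eval (i : ℚ)), ?_⟩
  filter_upwards [eventually_ge_atTop N] with n hn
  obtain ⟨k, rfl⟩ := Nat.exists_eq_add_of_le hn
  have h : ∑ x ∈ Finset.range k, P.eval ((N + x : ℕ) : ℚ) =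
      ∑ x ∈ Finset.range k, (f (N + x) : ℚ) :=
    Finset.sum_congr rfl fun i _ => hN _ (by omega)
  rw [eval_add, hQ, eval_C]
  push_cast [Finset.sum_range_add] at h ⊢
  rw [h]
  ring

/-- A descending sequence of lower sets in a well-quasi-ordered type stabilizes. -/
theorem exists_forall_ge_eq_of_isLowerSet {α : Type*} [Preorder α] [WellQuasiOrderedLE α]
    (L : ℕ → Set α) (hL : ∀ n, IsLowerSet (L n)) (hanti : Antitone L) :
    ∃ N, ∀ n ≥ N, L n = L N := by
  by_contra! h
  have h' : ∀ N, ∃ n, N ≤ n ∧ ∃ a, a ∈ L N ∧ a ∉ L n := by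
    intro N
    obtain ⟨n, hn, hne⟩ := h N
    refine ⟨n, hn, ?_⟩
    by_contra! hsub
    exact hne (Set.Subset.antisymm (hanti hn) hsub)
  choose e hle a ha hna using h'
  -- Along `e`, each `a` leaves the sequence before the next one is chosen.
  let s : ℕ → ℕ := fun k => e^[k] 0
  have hsmono : Monotone s := monotone_nat_of_le_succ fun k => by
    simp only [s, Function.iterate_succ', Function.comp]
    exact hle _
  obtain ⟨i, j, hij, hr⟩ := (wellQuasiOrdered_le (α := α)) (fun k => a (s k))
  have h1 : a (s i) ∈ L (s j) := hL _ hr (ha _)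
  have h2 : s (i + 1) ≤ s j := hsmono hij
  refine hna (s i) (hanti ?_ h1)
  simpa only [s, Function.iterate_succ', Function.comp] using h2

theorem finite_setOf_sum_eq (r n : ℕ) : {a : Fin r → ℕ | ∑ i, a i = n}.Finite := by
  refine (Set.finite_Iic (fun _ : Fin r => n)).subset fun a ha i => ?_
  rw [Set.mem_ofPred_eq] at ha
  rw [← ha]
  exact Finset.single_le_sum (f := a) (fun _ _ => Nat.zero_le _) (Finset.mem_univ i)

/-- The number of points of total degree `n` in a set of exponent vectors. -/
noncomputable def degreeCount {r : ℕ} (L : Set (Fin r → ℕ)) (n : ℕ) : ℕ :=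
  {a : Fin r → ℕ | a ∈ L ∧ ∑ i, a i = n}.ncard

theorem degreeCount_succ {r : ℕ} (L : Set (Fin (r + 1) → ℕ)) (n : ℕ) :
    degreeCount L n =
      ∑ j ∈ Finset.range (n + 1), degreeCount {a | (Fin.cons j a : Fin (r + 1) → ℕ) ∈ L} (n - j) := by
  classical
  have hfin : ∀ j, {a : Fin r → ℕ | (Fin.cons j a : Fin (r + 1) → ℕ) ∈ L ∧ ∑ i, a i = n - j}.Finite :=
    fun j => (finite_setOf_sum_eq r (n - j)).subset fun a ha => ha.2
  have hfin' : {a : Fin (r + 1) → ℕ | a ∈ L ∧ ∑ i, a i = n}.Finite :=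
    (finite_setOf_sum_eq (r + 1) n).subset fun a ha => ha.2
  unfold degreeCount
  simp only [Set.mem_ofPred_eq]
  rw [Set.ncard_eq_toFinset_card _ hfin',
    Finset.card_eq_sum_card_fiberwise (f := fun a => a 0) (t := Finset.range (n + 1))]
  · refine Finset.sum_congr rfl fun j hj => ?_
    rw [Set.ncard_eq_toFinset_card _ (hfin j)]
    refine Finset.card_bij' (fun a _ => Fin.tail a) (fun a _ => Fin.cons j a) ?_ ?_ ?_ ?_
    · intro a ha
      simp only [Finset.mem_filter, Set.Finite.mem_toFinset, Set.mem_ofPred_eq] at ha ⊢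
      obtain ⟨⟨h1, h2⟩, rfl⟩ := ha
      rw [Fin.cons_self_tail]
      refine ⟨h1, ?_⟩
      rw [Fin.sum_univ_succ] at h2
      simp only [Fin.tail]
      omega
    · intro a ha
      simp only [Finset.mem_filter, Set.Finite.mem_toFinset, Set.mem_ofPred_eq,
        Finset.mem_range] at ha hj ⊢
      refine ⟨⟨ha.1, ?_⟩, by simp⟩
      rw [Fin.sum_univ_succ]
      simp only [Fin.cons_zero, Fin.cons_succ]
      omega
    · intro a ha
      simp only [Finset.mem_filter] at ha
      obtain ⟨_, rfl⟩ := ha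
      exact Fin.cons_self_tail a
    · intro a ha
      exact Fin.tail_cons _ _
  · intro a ha
    simp only [Set.Finite.coe_toFinset, Set.mem_ofPred_eq] at ha
    simp only [Finset.coe_range, Set.mem_Iio]
    have := Fin.sum_univ_succ a
    omega

/-- The number of points of degree `n` of a lower set in `ℕ ^ r` is eventually polynomial in `n`:
the slices of the lower set along the first coordinate stabilize, so that the count is a finite sum
of shifted counts and one cumulative count in dimension `r - 1`. -/
theorem eventuallyPolynomial_degreeCount {r : ℕ} (L : Set (Fin r → ℕ)) (hL : IsLowerSet L) :
    EventuallyPolynomial (degreeCount L) := by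
  induction r with
  | zero =>
    refine eventuallyPolynomial_zero.congr ?_
    filter_upwards [eventually_gt_atTop 0] with n hn
    have : {a : Fin 0 → ℕ | a ∈ L ∧ ∑ i, a i = n} = ∅ := by
      ext a
      simp only [Set.mem_ofPred_eq, Finset.univ_eq_empty, Finset.sum_empty, Set.mem_empty_iff_false,
        iff_false, not_and]
      omega
    rw [degreeCount, this, Set.ncard_empty]
  | succ r ih =>
    let S : ℕ → Set (Fin r → ℕ) := fun j => {a | (Fin.cons j a : Fin (r + 1) → ℕ) ∈ L}
    have hS : ∀ j, IsLowerSet (S j) := fun j a b hba ha =>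
      hL (Fin.cons_le_cons.2 ⟨le_rfl, hba⟩) ha
    have hanti : Antitone S := fun i j hij a ha => hL (Fin.cons_le_cons.2 ⟨hij, le_rfl⟩) ha
    obtain ⟨N, hN⟩ := exists_forall_ge_eq_of_isLowerSet S hS hanti
    have h1 : EventuallyPolynomial (fun n => ∑ j ∈ Finset.range N, degreeCount (S j) (n - j)) :=
      EventuallyPolynomial.sum _ _ fun j _ => (ih (S j) (hS j)).shift j
    have h2 := ((ih (S N) (hS N)).sum_range).shift N
    have h3 : EventuallyPolynomial (fun n => degreeCount (S N) (n - N)) := (ih _ (hS N)).shift N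
    refine ((h1.add h2).add h3).congr ?_
    filter_upwards [eventually_ge_atTop N] with n hn
    obtain ⟨k, rfl⟩ := Nat.exists_eq_add_of_le hn
    rw [degreeCount_succ, show N + k + 1 = N + (k + 1) by omega, Finset.sum_range_add, add_assoc]
    congr 1
    rw [Nat.add_sub_cancel_left, ← Finset.sum_range_succ, ← Finset.sum_range_reflect]
    refine Finset.sum_congr rfl fun i hi => ?_
    rw [Finset.mem_range] at hi
    change degreeCount (S (N + (k + 1 - 1 - i))) _ = _
    rw [hN _ (by omega)]
    congr 1
    omega

/-- A polynomial that is eventually squeezed between `0` and `Q` on the natural numbers has degree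
at most that of `Q`. -/
theorem Polynomial.degree_le_of_eventually_le {P Q : ℚ[X]}
    (h : ∀ᶠ n : ℕ in atTop, 0 ≤ P.eval (n : ℚ) ∧ P.eval (n : ℚ) ≤ Q.eval (n : ℚ)) :
    P.degree ≤ Q.degree := by
  by_contra! hlt
  have hP : P ≠ 0 := by
    rintro rfl
    simp at hlt
  have hcast := tendsto_natCast_atTop_atTop (R := ℚ)
  have h1 := hcast.eventually (P.eventually_atTop_not_isRoot hP)
  have h2 := hcast.eventually ((isLittleO_atTop_of_degree_lt Q P hlt).def
    (show (0 : ℝ) < 1 / 2 by norm_num))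
  obtain ⟨n, ⟨h0, h3⟩, h4, h5⟩ := (h.and (h1.and h2)).exists
  have h6 : |Q.eval (n : ℚ)| ≤ 1 / 2 * |P.eval (n : ℚ)| := by
    have h7 : ((|Q.eval (n : ℚ)| : ℚ) : ℝ) ≤ ((1 / 2 * |P.eval (n : ℚ)| : ℚ) : ℝ) := by
      push_cast
      simpa [← Rat.norm_cast_real] using h5
    exact_mod_cast h7
  rw [abs_of_nonneg h0, abs_of_nonneg (h0.trans h3)] at h6
  exact h4 (by
    rw [IsRoot.def]
    linarith)

theorem Polynomial.eq_of_eventually_eval_eq {P Q : ℚ[X]}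
    (h : ∀ᶠ n : ℕ in atTop, P.eval (n : ℚ) = Q.eval (n : ℚ)) : P = Q := by
  refine eq_of_infinite_eval_eq P Q ?_
  obtain ⟨N, hN⟩ := eventually_atTop.1 h
  refine Set.Infinite.mono ?_ ((Set.Ici_infinite N).image (Nat.cast_injective (R := ℚ)).injOn)
  rintro _ ⟨n, hn, rfl⟩
  exact hN n hn

/-! ### Monomial filtrations and the Hilbert–Samuel function -/

theorem Ideal.length_quotient_le_of_le {R : Type*} [CommRing R] {I J : Ideal R} (h : I ≤ J) :
    Module.length R (R ⧸ J) ≤ Module.length R (R ⧸ I) :=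
  Module.length_le_of_surjective (Submodule.factor h) (Submodule.factor_surjective h)

/-- The exact sequence `0 → R / (J : x) → R / J → R / (J + xR) → 0` on the level of lengths. -/
theorem Ideal.length_quotient_eq_add {R : Type*} [CommRing R] (J K : Ideal R) (x : R)
    (hK : ∀ r, r ∈ K ↔ r * x ∈ J) :
    Module.length R (R ⧸ J) =
      Module.length R (R ⧸ K) + Module.length R (R ⧸ (J ⊔ Ideal.span {x})) := by
  let f : (R ⧸ K) →ₗ[R] (R ⧸ J) :=
    Submodule.mapQ K J (LinearMap.toSpanSingleton R R x) fun r hr => (hK r).1 hr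
  let g : (R ⧸ J) →ₗ[R] (R ⧸ (J ⊔ Ideal.span {x})) := Submodule.factor le_sup_left
  refine Module.length_eq_add_of_exact f g ?_ (Submodule.factor_surjective _) ?_
  · rw [← LinearMap.ker_eq_bot, LinearMap.ker_eq_bot']
    intro a ha
    obtain ⟨a, rfl⟩ := Submodule.mkQ_surjective _ a
    refine (Submodule.Quotient.mk_eq_zero _).2 ((hK a).2 ?_)
    exact (Submodule.Quotient.mk_eq_zero _).1 ha
  · intro b
    obtain ⟨b, rfl⟩ := Submodule.mkQ_surjective _ b
    constructor
    · intro hb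
      have hb' : b ∈ J ⊔ Ideal.span {x} := (Submodule.Quotient.mk_eq_zero _).1 hb
      obtain ⟨y, hy, z, hz, rfl⟩ := Submodule.mem_sup.1 hb'
      obtain ⟨c, rfl⟩ := Ideal.mem_span_singleton'.1 hz
      refine ⟨Submodule.Quotient.mk c, ?_⟩
      refine (Submodule.Quotient.eq _).2 ?_
      simpa [LinearMap.toSpanSingleton_apply] using hy
    · rintro ⟨a, ha⟩
      obtain ⟨a, rfl⟩ := Submodule.mkQ_surjective _ a
      rw [← ha]
      refine (Submodule.Quotient.mk_eq_zero _).2 ?_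
      exact Submodule.mem_sup_right (Ideal.mem_span_singleton'.2 ⟨a, rfl⟩)

theorem IsLocalRing.length_quotient_maximalIdeal (R : Type*) [CommRing R] [IsLocalRing R] :
    Module.length R (R ⧸ maximalIdeal R) = 1 := by
  rw [Module.length_eq_one_iff, isSimpleModule_iff_isCoatom]
  exact (maximalIdeal.isMaximal R).out

theorem exists_fin_span_range_eq {R : Type*} [CommRing R] {I : Ideal R} (hI : I.FG) :
    ∃ (r : ℕ) (x : Fin r → R), Ideal.span (Set.range x) = I :=
  Submodule.fg_iff_exists_fin_generating_family.1 hI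

open Classical in
/-- Adding to an ideal `J` an element `x` with `𝔪 x ⊆ J` lowers the colength by `0` or `1`. -/
theorem IsLocalRing.length_quotient_eq_add_ite {R : Type*} [CommRing R] [IsLocalRing R]
    (J : Ideal R) (x : R) (hx : ∀ r ∈ maximalIdeal R, r * x ∈ J) :
    Module.length R (R ⧸ J) =
      Module.length R (R ⧸ (J ⊔ Ideal.span {x})) + if x ∈ J then 0 else 1 := by
  split_ifs with h
  · rw [sup_eq_left.2 ((Ideal.span_singleton_le_iff_mem _).2 h), add_zero]
  · rw [Ideal.length_quotient_eq_add J (maximalIdeal R) x, length_quotient_maximalIdeal, add_comm]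
    refine fun r => ⟨hx r, fun hr => ?_⟩
    by_contra hr'
    have hu : IsUnit r := by simpa using hr'
    obtain ⟨u, rfl⟩ := hu
    refine h ?_
    simpa using J.mul_mem_left (↑u⁻¹) hr

section MonomialFiltration

open scoped MonomialOrder
open MonomialOrder

variable {R : Type u} [CommRing R] {r : ℕ} (x : Fin r → R)

/-- The value at `x` of the monomial with exponent vector `a`. -/
def monomialValue (a : Fin r →₀ ℕ) : R := a.prod fun i k => x i ^ k

theorem monomialValue_add (a b : Fin r →₀ ℕ) :
    monomialValue x (a + b) = monomialValue x a * monomialValue x b :=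
  Finsupp.prod_add_index' (fun _ => pow_zero _) fun _ _ _ => pow_add _ _ _

@[simp]
theorem monomialValue_single (i : Fin r) : monomialValue x (Finsupp.single i 1) = x i := by
  simp [monomialValue]

theorem monomialValue_mem (a : Fin r →₀ ℕ) :
    monomialValue x a ∈ Ideal.span (Set.range x) ^ a.degree := by
  rw [monomialValue, Finsupp.degree_eq_sum, Finsupp.prod_fintype _ _ (by simp),
    ← Finset.prod_pow_eq_pow_sum]
  exact Ideal.prod_mem_prod fun i _ =>
    Ideal.pow_mem_pow (Ideal.subset_span (Set.mem_range_self i)) _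

theorem span_range_pow_eq_span_monomialValue (n : ℕ) :
    Ideal.span (Set.range x) ^ n = Ideal.span (monomialValue x '' {a | a.degree = n}) := by
  apply le_antisymm
  · induction n with
    | zero =>
      have h : (1 : R) ∈ Ideal.span (monomialValue x '' {a | a.degree = 0}) :=
        Ideal.subset_span ⟨0, by simp, by simp [monomialValue]⟩
      rw [(Ideal.eq_top_iff_one _).2 h]
      exact le_top
    | succ n ih =>
      rw [pow_succ]
      refine (Ideal.mul_mono_left ih).trans ?_
      rw [Ideal.span_mul_span', Ideal.span_le]
      rintro _ ⟨_, ⟨a, ha, rfl⟩, _, ⟨i, rfl⟩, rfl⟩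
      refine Ideal.subset_span ⟨a + Finsupp.single i 1, ?_, ?_⟩
      · rw [Set.mem_ofPred_eq] at ha ⊢
        rw [map_add, ha, Finsupp.degree_single]
      · simp [monomialValue_add]
  · rw [Ideal.span_le]
    rintro _ ⟨a, rfl, rfl⟩
    exact monomialValue_mem x a

/-- The ideal generated by the monomials that are larger than `a` in the degree-lexicographic
order. -/
def largerMonomials (a : Fin r →₀ ℕ) : Ideal R :=
  Ideal.span (monomialValue x '' {b | a ≺[degLex] b})

variable {x}

theorem mem_largerMonomials {a b : Fin r →₀ ℕ} (h : a ≺[degLex] b) :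
    monomialValue x b ∈ largerMonomials x a :=
  Ideal.subset_span ⟨b, h, rfl⟩

theorem degLex_lt_of_degree_lt {a b : Fin r →₀ ℕ} (h : a.degree < b.degree) : a ≺[degLex] b := by
  rw [degLex_lt_iff, Finsupp.DegLex.lt_iff]
  exact Or.inl h

theorem degree_le_of_degLex_le {a b : Fin r →₀ ℕ} (h : a ≼[degLex] b) : a.degree ≤ b.degree := by
  by_contra! hlt
  exact (degLex_lt_of_degree_lt hlt).not_ge h

theorem span_range_pow_le_largerMonomials (a : Fin r →₀ ℕ) {n : ℕ} (h : a.degree < n) :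
    Ideal.span (Set.range x) ^ n ≤ largerMonomials x a := by
  rw [span_range_pow_eq_span_monomialValue]
  refine Ideal.span_mono (Set.image_mono ?_)
  rintro b rfl
  exact degLex_lt_of_degree_lt h

theorem mul_monomialValue_mem_largerMonomials {a : Fin r →₀ ℕ} {y : R}
    (hy : y ∈ largerMonomials x a) (c : Fin r →₀ ℕ) :
    y * monomialValue x c ∈ largerMonomials x (a + c) := by
  refine Submodule.span_induction (p := fun y _ => y * monomialValue x c ∈ largerMonomials x (a + c))
    ?_ ?_ ?_ ?_ hy
  · rintro _ ⟨b, hb, rfl⟩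
    rw [← monomialValue_add]
    refine mem_largerMonomials ?_
    rw [map_add, map_add]
    exact add_lt_add_left hb _
  · simp
  · intro y z _ _ hy hz
    rw [add_mul]
    exact add_mem hy hz
  · intro s y _ hy
    rw [smul_eq_mul, mul_assoc]
    exact Ideal.mul_mem_left _ _ hy

theorem mul_monomialValue_mem_of_mem_span {y : R} (hy : y ∈ Ideal.span (Set.range x))
    (a : Fin r →₀ ℕ) : y * monomialValue x a ∈ largerMonomials x a := by
  refine span_range_pow_le_largerMonomials a (Nat.lt_succ_self _) ?_
  rw [pow_succ', mul_comm y, mul_comm (Ideal.span _)]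
  exact Ideal.mul_mem_mul (monomialValue_mem x a) hy

variable (x) in
/-- The exponents `a` of the standard monomials: those that do not lie in the ideal generated by the
larger monomials. -/
def standardExponents : Set (Fin r → ℕ) :=
  {a | monomialValue x (Finsupp.equivFunOnFinite.symm a) ∉
    largerMonomials x (Finsupp.equivFunOnFinite.symm a)}

variable (x) in
theorem isLowerSet_standardExponents : IsLowerSet (standardExponents x) := by
  intro a b hba ha hb
  refine ha ?_
  obtain ⟨c, hc⟩ : ∃ c, Finsupp.equivFunOnFinite.symm a = Finsupp.equivFunOnFinite.symm b + c :=
    exists_add_of_le fun i => by simpa using hba i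
  rw [hc, monomialValue_add]
  exact mul_monomialValue_mem_largerMonomials hb c

open Classical in
/-- The colength of an ideal generated by all monomials outside an initial segment `s` of the
degree-lexicographic order is the number of standard monomials in `s`. -/
theorem length_quotient_span_compl [IsLocalRing R]
    (hx : Ideal.span (Set.range x) = maximalIdeal R) (s : Finset (Fin r →₀ ℕ))
    (hs : ∀ a ∈ s, ∀ b, b ≼[degLex] a → b ∈ s) :
    Module.length R (R ⧸ Ideal.span (monomialValue x '' {b | b ∉ s})) =
      ({a ∈ s | monomialValue x a ∉ largerMonomials x a}.card : ℕ) := by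
  induction s using Finset.induction_on_max_value (f := (degLex (σ := Fin r)).toSyn) with
  | empty =>
    have h : (1 : R) ∈ Ideal.span (monomialValue x '' {b | b ∉ (∅ : Finset (Fin r →₀ ℕ))}) :=
      Ideal.subset_span ⟨0, by simp, by simp [monomialValue]⟩
    rw [(Ideal.eq_top_iff_one _).2 h]
    have : Subsingleton (R ⧸ (⊤ : Ideal R)) := Ideal.Quotient.subsingleton_iff.2 rfl
    simp [Module.length_eq_zero]
  | insert a s ha hmax ih =>
    have h1 : {b | b ∉ insert a s} = {b | a ≺[degLex] b} := by
      ext b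
      simp only [Set.mem_ofPred_eq]
      constructor
      · intro hb
        by_contra! hle
        exact hb (hs a (by simp) b hle)
      · intro hlt hb
        rcases Finset.mem_insert.1 hb with rfl | hb
        · exact lt_irrefl _ hlt
        · exact (hmax b hb).not_gt hlt
    have h2 : Ideal.span (monomialValue x '' {b | b ∉ s}) =
        largerMonomials x a ⊔ Ideal.span {monomialValue x a} := by
      have : {b | b ∉ s} = {b | a ≺[degLex] b} ∪ {a} := by
        rw [← h1]
        ext b
        by_cases hb : b = a
        · simp [hb, ha]
        · simp [hb]
      rw [this, Set.image_union, Ideal.span_union, Set.image_singleton, largerMonomials]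
    have hs' : ∀ c ∈ s, ∀ b, b ≼[degLex] c → b ∈ s := by
      intro c hc b hb
      rcases Finset.mem_insert.1 (hs c (by simp [hc]) b hb) with rfl | h
      · have := degLex.toSyn.injective (le_antisymm hb (hmax c hc))
        rwa [this]
      · exact h
    specialize ih hs'
    rw [h2] at ih
    rw [h1]
    change Module.length R (R ⧸ largerMonomials x a) = _
    rw [length_quotient_eq_add_ite _ (monomialValue x a), ih, Finset.filter_insert]
    · by_cases h : monomialValue x a ∈ largerMonomials x a
      · simp [h]
      · simp [h, ha]
    · intro y hy
      rw [← hx] at hy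
      exact mul_monomialValue_mem_of_mem_span hy a

end MonomialFiltration

section HilbertSamuel

variable {R : Type u} [CommRing R] [IsLocalRing R]

/-- The length of `R / 𝔪 ^ n` is the number of standard monomials of degree less than `n` in a
system of generators of `𝔪`. -/
theorem length_quotient_pow_eq_sum_degreeCount {r : ℕ} (x : Fin r → R)
    (hx : Ideal.span (Set.range x) = maximalIdeal R) (n : ℕ) :
    Module.length R (R ⧸ maximalIdeal R ^ n) =
      ((∑ i ∈ Finset.range n, degreeCount (standardExponents x) i : ℕ) : ℕ∞) := by
  classical
  have hfin : {a : Fin r →₀ ℕ | a.degree < n}.Finite := by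
    have h : (⋃ i ∈ Finset.range n, {a : Fin r → ℕ | ∑ j, a j = i}).Finite :=
      Set.Finite.biUnion (Finset.finite_toSet _) fun i _ => finite_setOf_sum_eq r i
    refine (h.preimage (f := Finsupp.equivFunOnFinite)
      Finsupp.equivFunOnFinite.injective.injOn).subset ?_
    intro a ha
    simpa [Finsupp.degree_eq_sum] using ha
  have h1 : Ideal.span (monomialValue x '' {b | b ∉ hfin.toFinset}) = maximalIdeal R ^ n := by
    rw [← hx]
    apply le_antisymm
    · rw [Ideal.span_le]
      rintro _ ⟨b, hb, rfl⟩
      simp only [Set.Finite.mem_toFinset, Set.mem_ofPred_eq, not_lt] at hb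
      exact Ideal.pow_le_pow_right hb (monomialValue_mem x b)
    · rw [span_range_pow_eq_span_monomialValue]
      refine Ideal.span_mono (Set.image_mono ?_)
      rintro b rfl
      simp
  rw [← h1, length_quotient_span_compl hx]
  · norm_cast
    rw [Finset.card_eq_sum_card_fiberwise (f := Finsupp.degree) (t := Finset.range n)]
    · refine Finset.sum_congr rfl fun i hi => ?_
      rw [degreeCount, ← Set.ncard_coe_finset]
      rw [Finset.mem_range] at hi
      rw [← Set.ncard_image_of_injective _ Finsupp.equivFunOnFinite.injective]
      congr 1
      ext a
      rw [Equiv.image_eq_preimage_symm]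
      simp only [Finset.coe_filter, Set.mem_preimage, Set.mem_ofPred_eq, Finset.mem_filter,
        Set.Finite.mem_toFinset, standardExponents, Finsupp.degree_eq_sum]
      simp only [Finsupp.equivFunOnFinite_symm_apply_apply]
      constructor
      · rintro ⟨⟨_, h⟩, h'⟩
        exact ⟨h, h'⟩
      · rintro ⟨h, h'⟩
        exact ⟨⟨by omega, h⟩, h'⟩
    · intro a ha
      simpa using (Finset.mem_filter.1 ha).1
  · intro a ha b hb
    simp only [Set.Finite.mem_toFinset, Set.mem_ofPred_eq] at ha ⊢
    exact (degree_le_of_degLex_le hb).trans_lt ha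

theorem length_quotient_pow_ne_top (hR : (maximalIdeal R).FG) (n : ℕ) :
    Module.length R (R ⧸ maximalIdeal R ^ n) ≠ ⊤ := by
  obtain ⟨r, x, hx⟩ := exists_fin_span_range_eq hR
  rw [length_quotient_pow_eq_sum_degreeCount x hx]
  exact ENat.natCast_ne_top _

variable (R) in
/-- The Hilbert–Samuel function `n ↦ length (R / 𝔪 ^ n)` with values in `ℕ`. The value is meaningful
when the length is finite, as it is whenever `𝔪` is finitely generated. -/
noncomputable def hilbertSamuel (n : ℕ) : ℕ :=
  (Module.length R (R ⧸ maximalIdeal R ^ n)).toNat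

theorem coe_hilbertSamuel (hR : (maximalIdeal R).FG) (n : ℕ) :
    (hilbertSamuel R n : ℕ∞) = Module.length R (R ⧸ maximalIdeal R ^ n) :=
  ENat.natCast_toNat (length_quotient_pow_ne_top hR n)

theorem eventuallyPolynomial_hilbertSamuel (hR : (maximalIdeal R).FG) :
    EventuallyPolynomial (hilbertSamuel R) := by
  obtain ⟨r, x, hx⟩ := exists_fin_span_range_eq hR
  refine (eventuallyPolynomial_degreeCount _ (isLowerSet_standardExponents x)).sum_range.congr ?_
  refine Eventually.of_forall fun n => ?_
  rw [hilbertSamuel, length_quotient_pow_eq_sum_degreeCount x hx, ENat.toNat_natCast]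

theorem isHilbertSamuelPolynomial_iff (hR : (maximalIdeal R).FG) (P : ℚ[X]) :
    IsHilbertSamuelPolynomial R P ↔ ∀ᶠ n : ℕ in atTop, P.eval (n : ℚ) = hilbertSamuel R n := by
  refine eventually_congr (Eventually.of_forall fun n => ?_)
  rw [← coe_hilbertSamuel hR]
  constructor
  · rintro ⟨l, h1, h2⟩
    rw [h2, Nat.cast_inj.1 h1]
  · exact fun h => ⟨_, rfl, h⟩

theorem exists_isHilbertSamuelPolynomial (hR : (maximalIdeal R).FG) :
    ∃ P, IsHilbertSamuelPolynomial R P := by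
  obtain ⟨P, hP⟩ := eventuallyPolynomial_hilbertSamuel hR
  exact ⟨P, (isHilbertSamuelPolynomial_iff hR P).2 hP⟩

theorem monotone_hilbertSamuel (hR : (maximalIdeal R).FG) : Monotone (hilbertSamuel R) := by
  intro m n hmn
  have h := Ideal.length_quotient_le_of_le (Ideal.pow_le_pow_right (I := maximalIdeal R) hmn)
  rwa [← coe_hilbertSamuel hR, ← coe_hilbertSamuel hR, Nat.cast_le] at h

theorem hilbertSamuel_pos (hR : (maximalIdeal R).FG) {n : ℕ} (hn : n ≠ 0) :
    0 < hilbertSamuel R n := by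
  have h : 0 < Module.length R (R ⧸ maximalIdeal R ^ n) := by
    rw [Module.length_pos_iff, Ideal.Quotient.nontrivial_iff]
    exact ((Ideal.pow_le_self hn).trans_lt (maximalIdeal.isMaximal R).ne_top.lt_top).ne
  rw [← coe_hilbertSamuel hR] at h
  exact_mod_cast h

theorem IsHilbertSamuelPolynomial.ne_zero (hR : (maximalIdeal R).FG) {P : ℚ[X]}
    (hP : IsHilbertSamuelPolynomial R P) : P ≠ 0 := by
  rintro rfl
  obtain ⟨n, h1, h2⟩ :=
    (((isHilbertSamuelPolynomial_iff hR 0).1 hP).and (eventually_ne_atTop 0)).exists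
  have := hilbertSamuel_pos hR h2
  rw [eval_zero] at h1
  exact this.ne (by exact_mod_cast h1)

end HilbertSamuel

/-! ### Pseudo-dimension and primary ideals -/

section QuotientRing

variable {R : Type u} [CommRing R] [IsLocalRing R]

theorem IsLocalRing.quotient_of_le {I : Ideal R} (hI : I ≤ maximalIdeal R) :
    IsLocalRing (R ⧸ I) :=
  have : Nontrivial (R ⧸ I) :=
    Ideal.Quotient.nontrivial_iff.2 (hI.trans_lt (maximalIdeal.isMaximal R).ne_top.lt_top).ne
  .of_surjective' (Ideal.Quotient.mk I) Ideal.Quotient.mk_surjective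

theorem IsLocalRing.maximalIdeal_quotient (I : Ideal R) [IsLocalRing (R ⧸ I)] :
    maximalIdeal (R ⧸ I) = (maximalIdeal R).map (Ideal.Quotient.mk I) := by
  have hI : I ≠ ⊤ := Ideal.Quotient.nontrivial_iff.1 inferInstance
  refine (eq_maximalIdeal ?_).symm
  exact Ideal.IsMaximal.map_of_surjective_of_ker_le Ideal.Quotient.mk_surjective
    (by simpa using le_maximalIdeal hI)

theorem IsLocalRing.maximalIdeal_quotient_fg (hR : (maximalIdeal R).FG) (I : Ideal R)
    [IsLocalRing (R ⧸ I)] : (maximalIdeal (R ⧸ I)).FG := by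
  rw [maximalIdeal_quotient]
  exact hR.map _

/-- The Hilbert–Samuel function of `R / I` in terms of lengths of `R`-modules. -/
theorem coe_hilbertSamuel_quotient (hR : (maximalIdeal R).FG) (I : Ideal R)
    [IsLocalRing (R ⧸ I)] (n : ℕ) :
    (hilbertSamuel (R ⧸ I) n : ℕ∞) = Module.length R (R ⧸ (maximalIdeal R ^ n ⊔ I)) := by
  rw [coe_hilbertSamuel (maximalIdeal_quotient_fg hR I), maximalIdeal_quotient, ← Ideal.map_pow,
    ← Module.length_eq_of_surjective (S := R) (R := R ⧸ I) Ideal.Quotient.mk_surjective, sup_comm]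
  exact (DoubleQuot.quotQuotEquivQuotSupₐ R I (maximalIdeal R ^ n)).toLinearEquiv.length_eq

end QuotientRing

section PseudoDimension

variable {R : Type u} [CommRing R] [IsLocalRing R]

theorem hasPrimaryIdealGeneratedBy_iff (hR : (maximalIdeal R).FG) (n : ℕ) :
    HasPrimaryIdealGeneratedBy R n ↔ ∃ f : Fin n → R,
      Ideal.span (Set.range f) ≤ maximalIdeal R ∧
        ∃ k, maximalIdeal R ^ k ≤ Ideal.span (Set.range f) := by
  refine exists_congr fun f => ⟨?_, ?_⟩
  · rintro ⟨-, h⟩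
    exact ⟨h ▸ Ideal.le_radical, Ideal.exists_pow_le_of_le_radical_of_fg h.ge hR⟩
  · rintro ⟨h1, k, hk⟩
    have h : (Ideal.span (Set.range f)).radical = maximalIdeal R := by
      refine le_antisymm ?_ fun x hx => ⟨k, hk (Ideal.pow_mem_pow hx k)⟩
      exact (Ideal.radical_mono h1).trans_eq (maximalIdeal.isMaximal R).isPrime.radical
    exact ⟨Ideal.isPrimary_of_isMaximal_radical (h ▸ maximalIdeal.isMaximal R), h⟩

theorem isArtinianRing_iff_exists_pow_eq_bot (hR : (maximalIdeal R).FG) :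
    IsArtinianRing R ↔ ∃ k, maximalIdeal R ^ k = ⊥ := by
  constructor
  · intro h
    exact (isArtinianRing_iff_isNilpotent_maximalIdeal R).1 h
  · rintro ⟨k, hk⟩
    have : IsNoetherianRing R := IsNoetherianRing.of_prime fun P hP => by
      have h : maximalIdeal R ≤ P := hP.le_of_pow_le (n := k) (hk.trans_le bot_le)
      rwa [((maximalIdeal.isMaximal R).eq_of_le hP.ne_top h).symm]
    exact (isArtinianRing_iff_isNilpotent_maximalIdeal R).2 ⟨k, hk⟩

/-- `R` has pseudo-dimension at most `d` if and only if some `𝔪`-primary ideal is generated by `d`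
elements: a sequence of successive non-units with Artinian last quotient is lifted to `R`. -/
theorem pseudoDimLE_iff_hasPrimaryIdealGeneratedBy (hR : (maximalIdeal R).FG) (d : ℕ) :
    PseudoDimLE d R ↔ HasPrimaryIdealGeneratedBy R d := by
  induction d generalizing R with
  | zero =>
    rw [hasPrimaryIdealGeneratedBy_iff hR]
    refine (isArtinianRing_iff_exists_pow_eq_bot hR).trans ⟨?_, ?_⟩
    · rintro ⟨k, hk⟩
      exact ⟨Fin.elim0, by simp, k, hk.trans_le bot_le⟩
    · rintro ⟨f, -, k, hk⟩
      exact ⟨k, by simpa using hk⟩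
  | succ d ih =>
    have key : ∀ x ∈ maximalIdeal R, ∀ g : Fin d → R,
        (Ideal.span (Set.range g)).map (Ideal.Quotient.mk (Ideal.span {x})) =
            Ideal.span (Set.range (Ideal.Quotient.mk (Ideal.span {x}) ∘ g)) ∧
          Ideal.span (Set.range (Fin.cons x g : Fin (d + 1) → R)) =
            ((Ideal.span (Set.range g)).map (Ideal.Quotient.mk (Ideal.span {x}))).comap
              (Ideal.Quotient.mk (Ideal.span {x})) := by
      intro x hx g
      refine ⟨by rw [Ideal.map_span, Set.range_comp], ?_⟩
      rw [Ideal.comap_map_of_surjective _ Ideal.Quotient.mk_surjective, ← RingHom.ker_eq_comap_bot,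
        Ideal.mk_ker, Fin.range_cons, Ideal.span_insert, sup_comm]
    have hloc : ∀ x ∈ maximalIdeal R, IsLocalRing (R ⧸ Ideal.span {x}) := fun x hx =>
      quotient_of_le ((Ideal.span_singleton_le_iff_mem _).2 hx)
    rw [hasPrimaryIdealGeneratedBy_iff hR]
    constructor
    · rintro ⟨x, hx, h⟩
      have hx : x ∈ maximalIdeal R := hx
      have := hloc x hx
      have hR' := maximalIdeal_quotient_fg hR (Ideal.span {x})
      obtain ⟨f, h1, k, hk⟩ := (hasPrimaryIdealGeneratedBy_iff hR' d).1 ((ih hR').1 h)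
      obtain ⟨g, rfl⟩ : ∃ g : Fin d → R, Ideal.Quotient.mk (Ideal.span {x}) ∘ g = f :=
        ⟨fun i => (Ideal.Quotient.mk_surjective (f i)).choose,
          funext fun i => (Ideal.Quotient.mk_surjective (f i)).choose_spec⟩
      obtain ⟨e1, e2⟩ := key x hx g
      rw [← e1] at h1 hk
      refine ⟨Fin.cons x g, ?_, k, ?_⟩
      · rw [e2]
        exact (Ideal.comap_mono h1).trans (le_maximalIdeal (Ideal.comap_ne_top _
          (maximalIdeal.isMaximal _).ne_top))
      · rw [e2, ← Ideal.map_le_iff_le_comap, Ideal.map_pow, ← maximalIdeal_quotient]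
        exact hk
    · rintro ⟨f, h1, k, hk⟩
      have hx : f 0 ∈ maximalIdeal R := h1 (Ideal.subset_span ⟨0, rfl⟩)
      have := hloc (f 0) hx
      have hR' := maximalIdeal_quotient_fg hR (Ideal.span {f 0})
      refine ⟨f 0, hx, (ih hR').2 ((hasPrimaryIdealGeneratedBy_iff hR' d).2 ?_)⟩
      obtain ⟨e1, e2⟩ := key (f 0) hx (Fin.tail f)
      rw [Fin.cons_self_tail] at e2
      refine ⟨Ideal.Quotient.mk (Ideal.span {f 0}) ∘ Fin.tail f, ?_, k, ?_⟩
      · rw [← e1, maximalIdeal_quotient]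
        refine Ideal.map_mono (le_trans ?_ h1)
        rw [e2]
        exact Ideal.le_comap_map
      · rw [← e1, maximalIdeal_quotient, ← Ideal.map_pow, Ideal.map_le_iff_le_comap, ← e2]
        exact hk

theorem exists_hasPrimaryIdealGeneratedBy (hR : (maximalIdeal R).FG) :
    ∃ n, HasPrimaryIdealGeneratedBy R n := by
  obtain ⟨r, x, hx⟩ := exists_fin_span_range_eq hR
  exact ⟨r, (hasPrimaryIdealGeneratedBy_iff hR r).2 ⟨x, hx.le, 1, by rw [hx, pow_one]⟩⟩

theorem pseudoDim_eq_of_isLeast (hR : (maximalIdeal R).FG) {d : ℕ}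
    (hd : IsLeast {n | HasPrimaryIdealGeneratedBy R n} d) : pseudoDim R = d := by
  refine le_antisymm ?_ ?_
  · exact iInf₂_le d ((pseudoDimLE_iff_hasPrimaryIdealGeneratedBy hR d).2 hd.1)
  · refine le_iInf₂ fun n hn => ?_
    exact Nat.cast_le.2 (hd.2 ((pseudoDimLE_iff_hasPrimaryIdealGeneratedBy hR n).1 hn))

end PseudoDimension

section Transfer

variable {R : Type u} {S : Type v} [CommRing R] [CommRing S] [IsLocalRing R] [IsLocalRing S]

/-- Nakayama's lemma: a power of `𝔪` that is contained in `I` modulo the next power is contained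
in `I`. -/
theorem IsLocalRing.pow_le_of_pow_le_sup (hR : (maximalIdeal R).FG) {I : Ideal R} {k : ℕ}
    (h : maximalIdeal R ^ k ≤ I ⊔ maximalIdeal R ^ (k + 1)) : maximalIdeal R ^ k ≤ I := by
  rw [pow_succ'] at h
  exact Submodule.le_of_le_smul_of_le_jacobson_bot hR.pow (maximalIdeal_le_jacobson ⊥) h

/-- A homomorphism of local rings `φ : R → S` induces isomorphisms `R / 𝔪 ^ k → S / 𝔫 ^ k`
for all `k`. -/
structure InducesIsoOnPowerQuotients (φ : R →+* S) : Prop where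
  map_maximalIdeal : (maximalIdeal R).map φ = maximalIdeal S
  exists_sub_mem : ∀ (k : ℕ) (s : S), ∃ r, s - φ r ∈ maximalIdeal S ^ k
  mem_of_map_mem : ∀ (k : ℕ) (r : R), φ r ∈ maximalIdeal S ^ k → r ∈ maximalIdeal R ^ k

namespace InducesIsoOnPowerQuotients

variable {φ : R →+* S}

theorem fg (hφ : InducesIsoOnPowerQuotients φ) (hR : (maximalIdeal R).FG) :
    (maximalIdeal S).FG := hφ.map_maximalIdeal ▸ hR.map φ

theorem map_mem (hφ : InducesIsoOnPowerQuotients φ) {k : ℕ} {r : R} (hr : r ∈ maximalIdeal R ^ k) :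
    φ r ∈ maximalIdeal S ^ k := by
  rw [← hφ.map_maximalIdeal, ← Ideal.map_pow]
  exact Ideal.mem_map_of_mem φ hr

theorem hasPrimaryIdealGeneratedBy_iff (hφ : InducesIsoOnPowerQuotients φ)
    (hR : (maximalIdeal R).FG) (n : ℕ) :
    HasPrimaryIdealGeneratedBy R n ↔ HasPrimaryIdealGeneratedBy S n := by
  have hS := hφ.fg hR
  rw [_root_.hasPrimaryIdealGeneratedBy_iff hR, _root_.hasPrimaryIdealGeneratedBy_iff hS]
  constructor
  · rintro ⟨f, h1, k, hk⟩
    refine ⟨φ ∘ f, ?_, k, ?_⟩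
    · rw [Set.range_comp, ← Ideal.map_span, ← hφ.map_maximalIdeal]
      exact Ideal.map_mono h1
    · rw [Set.range_comp, ← Ideal.map_span, ← hφ.map_maximalIdeal, ← Ideal.map_pow]
      exact Ideal.map_mono hk
  · rintro ⟨g, h1, k, hk⟩
    -- Approximate the generators modulo `𝔫 ^ (k + 1)`; by Nakayama this does not matter.
    choose f hf using fun i => hφ.exists_sub_mem (k + 1) (g i)
    have hk' : maximalIdeal S ^ k ≤ Ideal.span (Set.range (φ ∘ f)) := by
      refine pow_le_of_pow_le_sup hS (hk.trans ?_)
      rw [Ideal.span_le]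
      rintro _ ⟨i, rfl⟩
      rw [← add_sub_cancel (φ (f i)) (g i)]
      exact add_mem (Submodule.mem_sup_left (Ideal.subset_span ⟨i, rfl⟩))
        (Submodule.mem_sup_right (hf i))
    refine ⟨f, ?_, k, pow_le_of_pow_le_sup hR fun y hy => ?_⟩
    · rw [Ideal.span_le]
      rintro _ ⟨i, rfl⟩
      have h2 : φ (f i) ∈ maximalIdeal S ^ 1 := by
        rw [pow_one, ← sub_sub_cancel (g i) (φ (f i))]
        exact sub_mem (h1 (Ideal.subset_span ⟨i, rfl⟩))
          (Ideal.pow_le_self (Nat.succ_ne_zero k) (hf i))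
      simpa using hφ.mem_of_map_mem 1 _ h2
    · obtain ⟨c, hc⟩ := (Ideal.mem_span_range_iff_exists_fun).1 (hk' (hφ.map_mem hy))
      choose e he using fun i => hφ.exists_sub_mem (k + 1) (c i)
      rw [← add_sub_cancel (∑ i, e i * f i) y]
      refine add_mem (Submodule.mem_sup_left ?_) (Submodule.mem_sup_right ?_)
      · exact Ideal.sum_mem _ fun i _ => Ideal.mul_mem_left _ _ (Ideal.subset_span ⟨i, rfl⟩)
      · refine hφ.mem_of_map_mem _ _ ?_
        rw [map_sub, ← hc, map_sum, ← Finset.sum_sub_distrib]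
        refine Ideal.sum_mem _ fun i _ => ?_
        rw [map_mul, Function.comp_apply, ← sub_mul]
        exact Ideal.mul_mem_right _ _ (he i)

theorem hilbertSamuel_eq (hφ : InducesIsoOnPowerQuotients φ) (n : ℕ) :
    hilbertSamuel R n = hilbertSamuel S n := by
  have hle : maximalIdeal R ^ n ≤ (maximalIdeal S ^ n).comap φ := fun r hr => hφ.map_mem hr
  let e : (R ⧸ maximalIdeal R ^ n) ≃+* (S ⧸ maximalIdeal S ^ n) :=
    RingEquiv.ofBijective (Ideal.quotientMap _ φ hle) <| by
      constructor
      · exact Ideal.quotientMap_injective' fun r hr => hφ.mem_of_map_mem n r hr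
      · intro s
        obtain ⟨s, rfl⟩ := Ideal.Quotient.mk_surjective s
        obtain ⟨r, hr⟩ := hφ.exists_sub_mem n s
        refine ⟨Ideal.Quotient.mk _ r, ?_⟩
        rw [Ideal.quotientMap_mk, eq_comm]
        exact Ideal.Quotient.eq.2 hr
  unfold hilbertSamuel
  congr 1
  rw [Module.length_eq_of_surjective (S := R) (R := R ⧸ maximalIdeal R ^ n)
      Ideal.Quotient.mk_surjective,
    Module.length_eq_of_surjective (S := S) (R := S ⧸ maximalIdeal S ^ n)
      Ideal.Quotient.mk_surjective]
  apply WithBot.coe_injective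
  rw [Module.coe_length, Module.coe_length]
  exact (Order.krullDim_eq_of_orderIso e.idealComapOrderIso).symm

end InducesIsoOnPowerQuotients

end Transfer

/-! ### The degree of the Hilbert–Samuel polynomial -/

section DegreeBounds

theorem exists_natCast_le_ringKrullDim_quotient {A : Type*} [CommRing A] {n : ℕ}
    (h : (n : WithBot ℕ∞) ≤ ringKrullDim A) :
    ∃ P : Ideal A, P.IsPrime ∧ (n : WithBot ℕ∞) ≤ ringKrullDim (A ⧸ P) := by
  obtain ⟨l, rfl⟩ := Order.le_krullDim_iff.1 h
  refine ⟨l.head.asIdeal, l.head.isPrime, ?_⟩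
  rw [ringKrullDim_quotient]
  refine Order.le_krullDim_iff.2 ⟨⟨l.length, fun i => ⟨l i, ?_⟩, fun i => l.step i⟩, rfl⟩
  exact l.head_le i

/-- The Hilbert–Samuel polynomial of `R` has degree at most the pseudo-dimension of `R`: each
element `x` of `𝔪` satisfies `H_R(n + 1) ≤ H_R(n) + H_{R/x}(n + 1)`, since `x 𝔪 ^ n ⊆ 𝔪 ^ (n + 1)`,
so that passing from `R / x` to `R` raises the degree by at most one. -/
theorem IsHilbertSamuelPolynomial.natDegree_le_of_pseudoDimLE {R : Type u} [CommRing R]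
    [IsLocalRing R] (hR : (maximalIdeal R).FG) {P : ℚ[X]} (hP : IsHilbertSamuelPolynomial R P)
    {d : ℕ} (hd : PseudoDimLE d R) : P.natDegree ≤ d := by
  induction d generalizing R P with
  | zero =>
    obtain ⟨k, hk⟩ := (isArtinianRing_iff_exists_pow_eq_bot hR).1 hd
    rw [natDegree_le_iff_degree_le]
    refine (degree_le_of_eventually_le (Q := C (hilbertSamuel R k : ℚ)) ?_).trans degree_C_le
    filter_upwards [(isHilbertSamuelPolynomial_iff hR P).1 hP, eventually_ge_atTop k] with n h1 h2
    have h3 : maximalIdeal R ^ n = maximalIdeal R ^ k := by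
      rw [hk, eq_bot_iff, ← hk]
      exact Ideal.pow_le_pow_right h2
    rw [h1, eval_C, hilbertSamuel, h3]
    exact ⟨Nat.cast_nonneg _, le_rfl⟩
  | succ d ih =>
    obtain ⟨x, hx, hd⟩ := hd
    have hx : x ∈ maximalIdeal R := hx
    have := quotient_of_le ((Ideal.span_singleton_le_iff_mem _).2 hx)
    have hR' := maximalIdeal_quotient_fg hR (Ideal.span {x})
    obtain ⟨Q, hQ⟩ := exists_isHilbertSamuelPolynomial hR'
    have hstep : ∀ n, hilbertSamuel R (n + 1) ≤
        hilbertSamuel R n + hilbertSamuel (R ⧸ Ideal.span {x}) (n + 1) := by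
      intro n
      have h := Ideal.length_quotient_eq_add (maximalIdeal R ^ (n + 1))
        (Submodule.comap (LinearMap.toSpanSingleton R R x) (maximalIdeal R ^ (n + 1))) x fun r => Iff.rfl
      have h2 : maximalIdeal R ^ n ≤
          Submodule.comap (LinearMap.toSpanSingleton R R x) (maximalIdeal R ^ (n + 1)) := fun r hr => by
        change r * x ∈ maximalIdeal R ^ (n + 1)
        rw [pow_succ]
        exact Ideal.mul_mem_mul hr hx
      have h3 := h.trans_le (add_le_add_left (Ideal.length_quotient_le_of_le h2) _)
      rw [← coe_hilbertSamuel hR, ← coe_hilbertSamuel hR, ← coe_hilbertSamuel_quotient hR] at h3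
      exact_mod_cast h3
    have hbound : ∀ n, hilbertSamuel R n ≤ n * hilbertSamuel (R ⧸ Ideal.span {x}) n := by
      intro n
      induction n with
      | zero =>
        have : Subsingleton (R ⧸ (maximalIdeal R ^ 0)) := by
          rw [pow_zero, Ideal.one_eq_top]
          exact Ideal.Quotient.subsingleton_iff.2 rfl
        simp [hilbertSamuel, Module.length_eq_zero]
      | succ n ihn =>
        calc hilbertSamuel R (n + 1)
            ≤ n * hilbertSamuel (R ⧸ Ideal.span {x}) n +
                hilbertSamuel (R ⧸ Ideal.span {x}) (n + 1) := (hstep n).trans (by gcongr)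
          _ ≤ n * hilbertSamuel (R ⧸ Ideal.span {x}) (n + 1) +
                hilbertSamuel (R ⧸ Ideal.span {x}) (n + 1) := by
              gcongr
              exact monotone_hilbertSamuel hR' (Nat.le_succ n)
          _ = _ := by ring
    have hdeg : P.degree ≤ (X * Q).degree := by
      refine degree_le_of_eventually_le ?_
      filter_upwards [(isHilbertSamuelPolynomial_iff hR P).1 hP,
        (isHilbertSamuelPolynomial_iff hR' Q).1 hQ] with n h1 h2
      rw [eval_mul, eval_X, h1, h2]
      exact ⟨Nat.cast_nonneg _, mod_cast hbound n⟩
    have h4 := natDegree_le_natDegree hdeg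
    have h5 := ih hR' hQ hd
    rw [natDegree_X_mul (hQ.ne_zero hR')] at h4
    omega

/-- If `x` is a nonzero element of the maximal ideal of a Noetherian local domain `B`, the
Hilbert–Samuel polynomial of `B / x` has smaller degree than that of `B`: by the Artin–Rees lemma
`(𝔪 ^ n : x) ⊆ 𝔪 ^ (n - c)` for a constant `c`, hence `H_{B/x}(n) ≤ H_B(n) - H_B(n - c)`. -/
theorem IsHilbertSamuelPolynomial.natDegree_quotient_lt {B : Type u} [CommRing B] [IsDomain B]
    [IsLocalRing B] [IsNoetherianRing B] {x : B} (hx0 : x ≠ 0)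
    [IsLocalRing (B ⧸ Ideal.span {x})] {P Q : ℚ[X]} (hP : IsHilbertSamuelPolynomial B P)
    (hQ : IsHilbertSamuelPolynomial (B ⧸ Ideal.span {x}) Q) : Q.natDegree < P.natDegree := by
  have hB : (maximalIdeal B).FG := IsNoetherian.noetherian _
  have hB' := maximalIdeal_quotient_fg hB (Ideal.span {x})
  obtain ⟨c, hc⟩ := Ideal.exists_pow_inf_eq_pow_smul (M := B) (maximalIdeal B) (Ideal.span {x})
  have hcolon : ∀ n ≥ c, ∀ r, r * x ∈ maximalIdeal B ^ n → r ∈ maximalIdeal B ^ (n - c) := by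
    intro n hn r hr
    have h1 : r * x ∈ maximalIdeal B ^ (n - c) • (Ideal.span {x} : Ideal B) := by
      refine Submodule.smul_mono le_rfl
        (inf_le_right : maximalIdeal B ^ c • ⊤ ⊓ Ideal.span {x} ≤ _) ?_
      rw [← hc n hn]
      exact ⟨by simpa using hr, Ideal.mul_mem_left _ _ (Ideal.mem_span_singleton_self x)⟩
    rw [smul_eq_mul, Ideal.mem_mul_span_singleton] at h1
    obtain ⟨z, hz, hzx⟩ := h1
    rwa [← mul_right_cancel₀ hx0 hzx]
  have hstep : ∀ n ≥ c, hilbertSamuel B (n - c) + hilbertSamuel (B ⧸ Ideal.span {x}) n ≤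
      hilbertSamuel B n := by
    intro n hn
    have h := Ideal.length_quotient_eq_add (maximalIdeal B ^ n)
      (Submodule.comap (LinearMap.toSpanSingleton B B x) (maximalIdeal B ^ n)) x fun r => Iff.rfl
    have h2 : Submodule.comap (LinearMap.toSpanSingleton B B x) (maximalIdeal B ^ n) ≤
        maximalIdeal B ^ (n - c) := fun r hr => hcolon n hn r hr
    have h3 := (add_le_add_left (Ideal.length_quotient_le_of_le h2) _).trans_eq h.symm
    rw [← coe_hilbertSamuel hB, ← coe_hilbertSamuel hB, ← coe_hilbertSamuel_quotient hB] at h3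
    exact_mod_cast h3
  have hPe := (isHilbertSamuelPolynomial_iff hB P).1 hP
  have hdeg : Q.degree ≤ (P - P.comp (X - C (c : ℚ))).degree := by
    refine degree_le_of_eventually_le ?_
    filter_upwards [hPe, (isHilbertSamuelPolynomial_iff hB' Q).1 hQ,
      (tendsto_sub_atTop_nat c).eventually hPe, eventually_ge_atTop c] with n h1 h2 h3 h4
    rw [Nat.cast_sub h4] at h3
    rw [eval_sub, eval_comp, eval_sub, eval_X, eval_C, h1, h2, h3]
    refine ⟨Nat.cast_nonneg _, ?_⟩
    rw [le_sub_iff_add_le, add_comm]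
    exact_mod_cast hstep n h4
  have hne := hP.ne_zero hB
  have hX : (X - C (c : ℚ)).natDegree = 1 := natDegree_X_sub_C _
  have hlead : (P.comp (X - C (c : ℚ))).leadingCoeff = P.leadingCoeff := by
    rw [leadingCoeff_comp (by rw [hX]; exact one_ne_zero), leadingCoeff_X_sub_C, one_pow, mul_one]
  have hcompne : P.comp (X - C (c : ℚ)) ≠ 0 := by
    rw [← leadingCoeff_ne_zero, hlead]
    exact leadingCoeff_ne_zero.2 hne
  have hcompdeg : P.degree = (P.comp (X - C (c : ℚ))).degree := by
    rw [degree_eq_natDegree hne, degree_eq_natDegree hcompne, natDegree_comp, hX, mul_one]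
  exact natDegree_lt_natDegree (hQ.ne_zero hB')
    (hdeg.trans_lt (degree_sub_lt_left hcompdeg hne hlead.symm))

/-- The Krull dimension of a Noetherian local ring is at most the degree of its Hilbert–Samuel
polynomial. -/
theorem IsHilbertSamuelPolynomial.le_natDegree_of_le_ringKrullDim {A : Type u} [CommRing A]
    [IsLocalRing A] [IsNoetherianRing A] {P : ℚ[X]} (hP : IsHilbertSamuelPolynomial A P) {n : ℕ}
    (hn : (n : WithBot ℕ∞) ≤ ringKrullDim A) : n ≤ P.natDegree := by
  induction n generalizing A P with
  | zero => exact Nat.zero_le _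
  | succ n ih =>
    have hA : (maximalIdeal A).FG := IsNoetherian.noetherian _
    obtain ⟨p, hp, hdim⟩ := exists_natCast_le_ringKrullDim_quotient hn
    have : IsLocalRing (A ⧸ p) := quotient_of_le (le_maximalIdeal hp.ne_top)
    have hB : (maximalIdeal (A ⧸ p)).FG := IsNoetherian.noetherian _
    obtain ⟨PB, hPB⟩ := exists_isHilbertSamuelPolynomial hB
    have hle : PB.natDegree ≤ P.natDegree := by
      refine natDegree_le_natDegree (degree_le_of_eventually_le ?_)
      filter_upwards [(isHilbertSamuelPolynomial_iff hA P).1 hP,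
        (isHilbertSamuelPolynomial_iff hB PB).1 hPB] with k h1 h2
      rw [h1, h2]
      refine ⟨Nat.cast_nonneg _, ?_⟩
      have h3 := Ideal.length_quotient_le_of_le (le_sup_left (a := maximalIdeal A ^ k) (b := p))
      rw [← coe_hilbertSamuel_quotient hA, ← coe_hilbertSamuel hA] at h3
      exact_mod_cast h3
    obtain ⟨x, hx, hx0⟩ : ∃ x ∈ maximalIdeal (A ⧸ p), x ≠ 0 := by
      rw [← Submodule.ne_bot_iff]
      intro hbot
      have hfield : IsField (A ⧸ p) := isField_iff_maximalIdeal_eq.2 hbot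
      rw [ringKrullDim_eq_zero_of_isField hfield] at hdim
      have : n + 1 ≤ 0 := by exact_mod_cast hdim
      omega
    have := quotient_of_le ((Ideal.span_singleton_le_iff_mem _).2 hx)
    obtain ⟨Q, hQ⟩ :=
      exists_isHilbertSamuelPolynomial (maximalIdeal_quotient_fg hB (Ideal.span {x}))
    have hdim' : (n : WithBot ℕ∞) ≤ ringKrullDim ((A ⧸ p) ⧸ Ideal.span {x}) := by
      have h := ringKrullDim_le_ringKrullDim_quotient_add_card {x}
        (by simpa [ringJacobson_eq_maximalIdeal] using hx)
      rw [Finset.coe_singleton, Finset.card_singleton] at h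
      have h2 := hdim.trans h
      push_cast at h2
      exact ENat.WithBot.add_le_add_one_right_iff.1 h2
    have h1 := ih hQ hdim'
    have h2 := hPB.natDegree_quotient_lt hx0 hQ
    omega

/-- In a Noetherian local ring the least number of generators of an `𝔪`-primary ideal is the Krull
dimension. -/
theorem ringKrullDim_eq_of_isLeast {A : Type u} [CommRing A] [IsLocalRing A] [IsNoetherianRing A]
    {d : ℕ} (hd : IsLeast {n | HasPrimaryIdealGeneratedBy A n} d) : ringKrullDim A = d := by
  have hA : (maximalIdeal A).FG := IsNoetherian.noetherian _
  rw [← maximalIdeal_height_eq_ringKrullDim]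
  refine le_antisymm ?_ ?_
  · obtain ⟨f, -, hf⟩ := hd.1
    have hmin : maximalIdeal A ∈ (Ideal.span (Set.range f)).minimalPrimes := by
      rw [← Ideal.radical_minimalPrimes, hf, Ideal.minimalPrimes_eq_subsingleton_self]
      rfl
    have h := Ideal.height_le_card_of_mem_minimalPrimes_span (Set.finite_range f) hmin
    have h2 : (Set.range f).ncard ≤ d := by
      rw [← Set.image_univ]
      exact (Set.ncard_image_le).trans (by simp)
    exact_mod_cast h.trans (Nat.cast_le.2 h2)
  · obtain ⟨s, hs, hcard⟩ :=
      (maximalIdeal A).exists_finset_card_eq_height_of_isNoetherianRing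
    rw [← hcard]
    have h : HasPrimaryIdealGeneratedBy A s.card := by
      have hrange : Set.range (fun i => (s.equivFin.symm i : A)) = s := by
        ext a
        constructor
        · rintro ⟨i, rfl⟩
          exact (s.equivFin.symm i).2
        · exact fun ha => ⟨s.equivFin ⟨a, ha⟩, by simp⟩
      have hrad : (Ideal.span (s : Set A)).radical = maximalIdeal A := by
        refine le_antisymm (Ideal.IsPrime.radical_le_iff (maximalIdeal.isMaximal A).isPrime |>.2
          hs.1.2) ?_
        rw [Ideal.radical_eq_sInf]
        refine le_sInf fun J hJ => ?_
        exact hs.2 ⟨hJ.2, hJ.1⟩ (le_maximalIdeal hJ.2.ne_top)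
      refine ⟨fun i => s.equivFin.symm i, ?_, ?_⟩
      · rw [hrange]
        exact Ideal.isPrimary_of_isMaximal_radical (hrad ▸ maximalIdeal.isMaximal A)
      · rw [hrange, hrad]
    exact_mod_cast hd.2 h

end DegreeBounds

/-! ### Complete local rings, completion and separated quotient -/

section CompleteLocalRing

open scoped MonomialOrder
open MonomialOrder

variable {A : Type u} [CommRing A] [IsLocalRing A]

/-- If the elements `f t` of an ideal `I`, with leading exponents `t ∈ T`, have the property that
every leading exponent of an element of `I` is above some `t ∈ T`, then every element of
`I ∩ 𝔪 ^ n` can be reduced to an element of `𝔪 ^ (n + 1)` by subtracting a combination of the `f t`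
with coefficients of high order. -/
theorem exists_sub_sum_mem_pow_succ {r : ℕ} {x : Fin r → A}
    (hx : Ideal.span (Set.range x) = maximalIdeal A) {I : Ideal A} {T : Finset (Fin r →₀ ℕ)}
    {f : (Fin r →₀ ℕ) → A} (hfI : ∀ t ∈ T, f t ∈ I)
    (hf : ∀ t ∈ T, f t - monomialValue x t ∈ largerMonomials x t)
    (hT : ∀ a, ∀ y ∈ I, y - monomialValue x a ∈ largerMonomials x a → ∃ t ∈ T, t ≤ a)
    {c : ℕ} (hc : ∀ t ∈ T, t.degree ≤ c) (n : ℕ) {y : A} (hyI : y ∈ I)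
    (hy : y ∈ maximalIdeal A ^ n) :
    ∃ g : (Fin r →₀ ℕ) → A, (∀ t, g t ∈ maximalIdeal A ^ (n - c)) ∧
      y - ∑ t ∈ T, g t * f t ∈ maximalIdeal A ^ (n + 1) := by
  classical
  -- Eliminate the monomials of degree `n` one by one, in increasing order.
  have key : ∀ s : Finset (Fin r →₀ ℕ), (∀ a ∈ s, a.degree = n) →
      (∀ a ∈ s, ∀ b, b.degree = n → a ≼[degLex] b → b ∈ s) →
      ∀ y ∈ I, y ∈ Ideal.span (monomialValue x '' s) ⊔ maximalIdeal A ^ (n + 1) →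
      ∃ g : (Fin r →₀ ℕ) → A, (∀ t, g t ∈ maximalIdeal A ^ (n - c)) ∧
        y - ∑ t ∈ T, g t * f t ∈ maximalIdeal A ^ (n + 1) := by
    intro s
    induction s using Finset.induction_on_min_value (f := (degLex (σ := Fin r)).toSyn) with
    | empty =>
      intro _ _ y _ hy
      exact ⟨0, by simp, by simpa using hy⟩
    | insert a s ha hmin ih =>
      intro hdeg hup y hyI hy
      have hadeg : a.degree = n := hdeg a (by simp)
      have ih' := ih (fun b hb => hdeg b (by simp [hb])) (fun b hb e he hbe => by
        rcases Finset.mem_insert.1 (hup b (by simp [hb]) e he hbe) with rfl | h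
        · have := degLex.toSyn.injective (le_antisymm (hmin b hb) hbe)
          rwa [this]
        · exact h)
      have hlarger : largerMonomials x a ≤
          Ideal.span (monomialValue x '' s) ⊔ maximalIdeal A ^ (n + 1) := by
        rw [largerMonomials, Ideal.span_le]
        rintro _ ⟨b, hb, rfl⟩
        rw [Set.mem_ofPred_eq] at hb
        rcases (degree_le_of_degLex_le hb.le).eq_or_lt with h | h
        · refine Submodule.mem_sup_left (Ideal.subset_span ⟨b, ?_, rfl⟩)
          rcases Finset.mem_insert.1 (hup a (by simp) b (h.symm.trans hadeg) hb.le) with rfl | h'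
          · exact absurd hb (lt_irrefl _)
          · exact h'
        · refine Submodule.mem_sup_right (Ideal.pow_le_pow_right (show n + 1 ≤ b.degree by omega) ?_)
          rw [← hx]
          exact monomialValue_mem x b
      have hlarger' : Ideal.span (monomialValue x '' s) ⊔ maximalIdeal A ^ (n + 1) ≤
          largerMonomials x a := by
        refine sup_le ?_ ?_
        · rw [Ideal.span_le]
          rintro _ ⟨b, hb, rfl⟩
          refine mem_largerMonomials (lt_of_le_of_ne (hmin b hb) fun h => ?_)
          rw [degLex.toSyn.injective h] at ha
          exact ha hb
        · rw [← hx]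
          exact span_range_pow_le_largerMonomials a (by omega)
      have hamem : monomialValue x a ∈ maximalIdeal A ^ n := by
        rw [← hadeg, ← hx]
        exact monomialValue_mem x a
      rw [Finset.coe_insert, Set.image_insert_eq, Ideal.span_insert, sup_assoc] at hy
      obtain ⟨_, hw, z, hz, rfl⟩ := Submodule.mem_sup.1 hy
      obtain ⟨w, rfl⟩ := Ideal.mem_span_singleton'.1 hw
      by_cases hwu : IsUnit w
      · obtain ⟨u, rfl⟩ := hwu
        obtain ⟨t, htT, hta⟩ := hT a (↑u⁻¹ * (↑u * monomialValue x a + z))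
          (I.mul_mem_left _ hyI) (by
            rw [mul_add, Units.inv_mul_cancel_left, add_sub_cancel_left]
            exact Ideal.mul_mem_left _ _ (hlarger' hz))
        obtain ⟨e, rfl⟩ := exists_add_of_le hta
        have hcoef : (u : A) * monomialValue x e ∈ maximalIdeal A ^ (n - c) := by
          refine Ideal.mul_mem_left _ _ (Ideal.pow_le_pow_right ?_ (hx ▸ monomialValue_mem x e))
          rw [map_add] at hadeg
          have := hc t htT
          omega
        have hred : ↑u * monomialValue x (t + e) + z - ↑u * monomialValue x e * f t ∈
            Ideal.span (monomialValue x '' s) ⊔ maximalIdeal A ^ (n + 1) := by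
          have h1 := hlarger (mul_monomialValue_mem_largerMonomials (hf t htT) e)
          have h2 : ↑u * monomialValue x (t + e) + z - ↑u * monomialValue x e * f t =
              z - ↑u * ((f t - monomialValue x t) * monomialValue x e) := by
            rw [monomialValue_add]
            ring
          rw [h2]
          exact sub_mem hz (Ideal.mul_mem_left _ _ h1)
        obtain ⟨g, hg1, hg2⟩ := ih' _ (sub_mem hyI (Ideal.mul_mem_left I _ (hfI t htT))) hred
        refine ⟨g + Pi.single t (↑u * monomialValue x e), fun t' => ?_, ?_⟩
        · refine add_mem (hg1 t') ?_
          by_cases h : t' = t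
          · subst h
            simpa using hcoef
          · simp [h]
        · convert! hg2 using 1
          simp only [Pi.add_apply, add_mul, Finset.sum_add_distrib, Pi.single_apply, ite_mul,
            zero_mul, Finset.sum_ite_eq', htT, if_true]
          ring
      · refine ih' _ hyI (add_mem (Submodule.mem_sup_right ?_) hz)
        rw [pow_succ']
        exact Ideal.mul_mem_mul ((mem_maximalIdeal w).2 hwu) hamem
  have hfin : {a : Fin r →₀ ℕ | a.degree = n}.Finite := by
    refine ((finite_setOf_sum_eq r n).preimage (f := Finsupp.equivFunOnFinite)
      Finsupp.equivFunOnFinite.injective.injOn).subset fun a ha => ?_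
    simpa [Finsupp.degree_eq_sum] using ha
  refine key hfin.toFinset (by simp) (fun a _ b hb _ => by simpa using hb) y hyI ?_
  refine Submodule.mem_sup_left ?_
  rw [Set.Finite.coe_toFinset, ← span_range_pow_eq_span_monomialValue, hx]
  exact hy

/-- In a complete local ring with finitely generated maximal ideal, an ideal that can be reduced
modulo all powers of `𝔪` by finitely many of its elements is generated by them. -/
theorem mem_span_of_forall_exists_sub_sum_mem [IsAdicComplete (maximalIdeal A) A] {ι : Type*}
    (T : Finset ι) (f : ι → A) {I : Ideal A} (hfI : ∀ t ∈ T, f t ∈ I) (c : ℕ)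
    (h : ∀ n, ∀ y ∈ I, y ∈ maximalIdeal A ^ n →
      ∃ g : ι → A, (∀ t, g t ∈ maximalIdeal A ^ (n - c)) ∧
        y - ∑ t ∈ T, g t * f t ∈ maximalIdeal A ^ (n + 1)) :
    I ≤ Ideal.span (f '' T) := by
  intro y hy
  choose! g hg1 hg2 using h
  let F : ∀ n : ℕ, {y // y ∈ I ∧ y ∈ maximalIdeal A ^ n} := fun n =>
    Nat.rec ⟨y, hy, by simp⟩
      (fun n z => ⟨z.1 - ∑ t ∈ T, g n z.1 t * f t,
        sub_mem z.2.1 (I.sum_mem fun t ht => Ideal.mul_mem_left _ _ (hfI t ht)),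
        hg2 n z.1 z.2.1 z.2.2⟩) n
  let G : ℕ → ι → A := fun n => g n (F n).1
  have hG : ∀ n t, G n t ∈ maximalIdeal A ^ (n - c) := fun n => hg1 n _ (F n).2.1 (F n).2.2
  have hF : ∀ n, (F (n + 1)).1 = (F n).1 - ∑ t ∈ T, G n t * f t := fun n => rfl
  have hsum : ∀ n, y = (F n).1 + ∑ t ∈ T, (∑ i ∈ Finset.range n, G i t) * f t := by
    intro n
    induction n with
    | zero => simp [F]
    | succ n ih =>
      rw [hF]
      simp only [Finset.sum_range_succ, add_mul, Finset.sum_add_distrib]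
      nth_rewrite 1 [ih]
      ring
  have hlim : ∀ t, ∃ L : A, ∀ n, (∑ i ∈ Finset.range (n + c), G i t) - L ∈ maximalIdeal A ^ n := by
    intro t
    obtain ⟨L, hL⟩ := IsPrecomplete.prec (I := maximalIdeal A) (M := A) inferInstance
      (f := fun n => ∑ i ∈ Finset.range (n + c), G i t) (by
        intro m n hmn
        obtain ⟨k, rfl⟩ := Nat.exists_eq_add_of_le hmn
        rw [SModEq.comm, SModEq.sub_mem, smul_eq_mul, Ideal.mul_top,
          show m + k + c = m + c + k by ring, Finset.sum_range_add, add_sub_cancel_left]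
        refine Ideal.sum_mem _ fun i _ => Ideal.pow_le_pow_right ?_ (hG _ t)
        omega)
    refine ⟨L, fun n => ?_⟩
    have := hL n
    rwa [SModEq.sub_mem, smul_eq_mul, Ideal.mul_top] at this
  choose L hL using hlim
  have hzero : y - ∑ t ∈ T, L t * f t = 0 := by
    refine IsHausdorff.haus (I := maximalIdeal A) (M := A) inferInstance _ fun n => ?_
    rw [SModEq.sub_mem, smul_eq_mul, Ideal.mul_top, sub_zero]
    nth_rewrite 1 [hsum (n + c)]
    rw [add_sub_assoc, ← Finset.sum_sub_distrib]
    refine add_mem (Ideal.pow_le_pow_right (by omega) (F (n + c)).2.2) (Ideal.sum_mem _ fun t _ => ?_)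
    rw [← sub_mul]
    exact Ideal.mul_mem_right _ _ (hL t n)
  rw [sub_eq_zero.1 hzero]
  exact Ideal.sum_mem _ fun t ht => Ideal.mul_mem_left _ _ (Ideal.subset_span ⟨t, ht, rfl⟩)

/-- A complete local ring whose maximal ideal is finitely generated is Noetherian. By Dickson's
lemma there are finitely many elements of an ideal `I` whose leading exponents lie below all leading
exponents of elements of `I`; division by them converges. -/
theorem IsLocalRing.isNoetherianRing_of_isAdicComplete (hA : (maximalIdeal A).FG)
    [IsAdicComplete (maximalIdeal A) A] : IsNoetherianRing A := by
  classical
  obtain ⟨r, x, hx⟩ := exists_fin_span_range_eq hA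
  refine (isNoetherianRing_iff_ideal_fg A).2 fun I => ?_
  let U : Set (Fin r →₀ ℕ) := {a | ∃ y ∈ I, y - monomialValue x a ∈ largerMonomials x a}
  have hfin : {a | Minimal (· ∈ U) a}.Finite :=
    WellQuasiOrderedLE.finite_of_isAntichain (setOfPred_minimal_antichain _)
  have hU : ∀ a, ∃ y : A, a ∈ U → y ∈ I ∧ y - monomialValue x a ∈ largerMonomials x a := by
    intro a
    by_cases ha : a ∈ U
    · obtain ⟨y, h1, h2⟩ := ha
      exact ⟨y, fun _ => ⟨h1, h2⟩⟩
    · exact ⟨0, fun h => absurd h ha⟩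
  choose f hf using hU
  have hTU : ∀ t ∈ hfin.toFinset, t ∈ U := fun t ht => (hfin.mem_toFinset.1 ht).1
  have hfI : ∀ t ∈ hfin.toFinset, f t ∈ I := fun t ht => (hf t (hTU t ht)).1
  have hle : I ≤ Ideal.span (f '' hfin.toFinset) := by
    refine mem_span_of_forall_exists_sub_sum_mem hfin.toFinset f hfI
      (hfin.toFinset.sup Finsupp.degree) fun n y hyI hy => ?_
    refine exists_sub_sum_mem_pow_succ hx hfI (fun t ht => (hf t (hTU t ht)).2) ?_
      (fun t ht => Finset.le_sup (f := Finsupp.degree) ht) n hyI hy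
    intro a y hyI hya
    obtain ⟨t, hta, ht⟩ := exists_minimal_le_of_wellFoundedLT (· ∈ U) a ⟨y, hyI, hya⟩
    exact ⟨t, hfin.mem_toFinset.2 ht, hta⟩
  have hge : Ideal.span (f '' hfin.toFinset) ≤ I := by
    rw [Ideal.span_le]
    rintro _ ⟨t, ht, rfl⟩
    exact hfI t ht
  rw [le_antisymm hle hge]
  exact ⟨hfin.toFinset.image f, by rw [Finset.coe_image]⟩

end CompleteLocalRing

section Completion

variable {R : Type u} [CommRing R] [IsLocalRing R]

theorem inducesIsoOnPowerQuotients_adicCompletion (hR : (maximalIdeal R).FG)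
    [IsLocalRing (AdicCompletion (maximalIdeal R) R)] :
    InducesIsoOnPowerQuotients (algebraMap R (AdicCompletion (maximalIdeal R) R)) := by
  have hmap := AdicCompletion.maximalIdeal_eq_map_of_fg hR
  have hmem : ∀ (k : ℕ) (s : AdicCompletion (maximalIdeal R) R),
      s ∈ maximalIdeal (AdicCompletion (maximalIdeal R) R) ^ k ↔
        AdicCompletion.eval (maximalIdeal R) R k s = 0 := by
    intro k s
    rw [hmap, ← Ideal.map_pow, ← Submodule.restrictScalars_mem R, ← Ideal.smul_top_eq_map,
      AdicCompletion.pow_smul_top_eq_ker_eval hR, LinearMap.mem_ker]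
  refine ⟨hmap.symm, fun k s => ?_, fun k r hr => ?_⟩
  · obtain ⟨r, hr⟩ := Submodule.mkQ_surjective _ (AdicCompletion.eval (maximalIdeal R) R k s)
    refine ⟨r, (hmem k _).2 ?_⟩
    rw [map_sub, ← hr, sub_eq_zero]
    rfl
  · rw [hmem] at hr
    have : r ∈ (maximalIdeal R ^ k • ⊤ : Submodule R R) := (Submodule.Quotient.mk_eq_zero _).1 hr
    simpa using this

theorem isNoetherianRing_adicCompletion (hR : (maximalIdeal R).FG) :
    IsNoetherianRing (AdicCompletion (maximalIdeal R) R) := by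
  have := AdicCompletion.isLocalRing_of_fg hR
  have := AdicCompletion.isAdicComplete_of_fg hR
  exact isNoetherianRing_of_isAdicComplete
    ((inducesIsoOnPowerQuotients_adicCompletion hR).fg hR)

theorem infinitesimals_le_maximalIdeal_pow (n : ℕ) : infinitesimals R ≤ maximalIdeal R ^ n :=
  iInf_le _ n

theorem isLocalRing_separatedQuotientRing : IsLocalRing (SeparatedQuotientRing R) :=
  quotient_of_le ((infinitesimals_le_maximalIdeal_pow 1).trans_eq (pow_one _))

theorem inducesIsoOnPowerQuotients_separatedQuotientRing [IsLocalRing (SeparatedQuotientRing R)] :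
    InducesIsoOnPowerQuotients (Ideal.Quotient.mk (infinitesimals R)) := by
  have hmap := maximalIdeal_quotient (infinitesimals R)
  refine ⟨hmap.symm, fun k s => ?_, fun k r hr => ?_⟩
  · obtain ⟨r, rfl⟩ := Ideal.Quotient.mk_surjective s
    exact ⟨r, by simp⟩
  · rw [hmap, ← Ideal.map_pow, Ideal.mem_quotient_iff_mem
      (infinitesimals_le_maximalIdeal_pow k)] at hr
    exact hr

end Completion

/-! ### Growth of algebras over a field -/

section Growth

theorem ringKrullDim_eq_of_isIntegral_of_injective {R S : Type*} [CommRing R] [CommRing S]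
    [Algebra R S] [Algebra.IsIntegral R S] (h : Function.Injective (algebraMap R S)) :
    ringKrullDim R = ringKrullDim S := by
  refine le_antisymm (iSup_le fun l => ?_) ?_
  · obtain ⟨Q, -, hQ, hQl⟩ := Ideal.exists_ideal_over_prime_of_isIntegral (S := S)
      l.head.asIdeal ⊥ (by
        rw [← RingHom.ker_eq_comap_bot, (RingHom.injective_iff_ker_eq_bot _).1 h]
        exact bot_le)
    have : Q.LiesOver l.head.asIdeal := ⟨hQl.symm⟩
    obtain ⟨L, hL, -⟩ := Ideal.exists_ltSeries_of_hasGoingUp l Q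
    rw [← hL]
    exact Order.LTSeries.length_le_krullDim L
  · exact Order.krullDim_le_of_strictMono (PrimeSpectrum.comap (algebraMap R S)) fun P Q hPQ =>
      Ideal.IsIntegral.comap_lt_comap (R := R) hPQ

/-- The Krull dimension of a finitely generated algebra over a field is its order of growth:
if `V` is a finite-dimensional generating subspace that contains `1`, then `dim V ^ n` is bounded
above and below, up to constants and rescaling of `n`, by `(n + 1) ^ s` with `s` the Krull dimension.
By Noether normalization this reduces to the growth of a polynomial ring. -/
theorem exists_ringKrullDim_eq_and_finrank_pow_bounds {k A : Type*} [Field k] [CommRing A]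
    [Nontrivial A] [Algebra k A] (V : Submodule k A) [FiniteDimensional k V] (h1 : (1 : A) ∈ V)
    (hV : ∀ a, ∃ n, a ∈ V ^ n) :
    ∃ s c r : ℕ, ringKrullDim A = s ∧
      (∀ n, (n + 1) ^ s ≤ Module.finrank k ↥(V ^ (c * n))) ∧
      ∀ n, Module.finrank k ↥(V ^ n) ≤ r * (c * (n + 1) + 1) ^ s := by
  classical
  have hmono : Monotone fun n => V ^ n := fun m n hmn =>
    pow_le_pow_right' (Submodule.one_le.2 h1) hmn
  obtain ⟨t, ht⟩ := (Module.Finite.iff_fg.1 inferInstance : V.FG)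
  have hft : Algebra.FiniteType k A := by
    refine ⟨t, ?_⟩
    have hle : ∀ n, V ^ n ≤ Subalgebra.toSubmodule (Algebra.adjoin k (t : Set A)) := by
      intro n
      induction n with
      | zero =>
        rw [pow_zero, Submodule.one_le]
        exact one_mem (Algebra.adjoin k (t : Set A))
      | succ n ih =>
        rw [pow_succ, Submodule.mul_le]
        intro a ha b hb
        refine mul_mem (S := Subalgebra k A) (ih ha) ?_
        rw [← ht] at hb
        exact Algebra.span_le_adjoin k _ hb
    rw [eq_top_iff]
    intro a _
    obtain ⟨n, hn⟩ := hV a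
    exact hle n hn
  obtain ⟨s, φ, hinj, hfin⟩ := exists_finite_inj_algHom_of_fg k A
  let y : Fin s → A := fun i => φ (MvPolynomial.X i)
  -- `b n` is the family of monomials in `y` with all exponents at most `n`.
  let b : ∀ n : ℕ, (Fin s → Fin (n + 1)) → A := fun n a => ∏ i, y i ^ (a i : ℕ)
  let B : ℕ → Submodule k A := fun n => Submodule.span k (Set.range (b n))
  have hbB : ∀ (n : ℕ) (a : Fin s → ℕ), (∀ i, a i ≤ n) → ∏ i, y i ^ a i ∈ B n := fun n a ha =>
    Submodule.subset_span ⟨fun i => ⟨a i, Nat.lt_succ_of_le (ha i)⟩, rfl⟩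
  have hBmul : ∀ m n, B m * B n ≤ B (m + n) := by
    intro m n
    rw [Submodule.span_mul_span, Submodule.span_le]
    rintro _ ⟨_, ⟨a, rfl⟩, _, ⟨a', rfl⟩, rfl⟩
    simp only [b, ← Finset.prod_mul_distrib, ← pow_add]
    exact hbB _ _ fun i => by have := (a i).2; have := (a' i).2; omega
  have hBmono : Monotone B := by
    intro m n hmn
    rw [Submodule.span_le]
    rintro _ ⟨a, rfl⟩
    exact hbB _ _ fun i => by have := (a i).2; omega
  have hBall : ∀ p, ∃ n, φ p ∈ B n := by
    intro p
    induction p using MvPolynomial.induction_on' with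
    | monomial a q =>
      refine ⟨a.degree, ?_⟩
      have h : φ (MvPolynomial.monomial a q) = q • ∏ i, y i ^ a i := by
        rw [MvPolynomial.aeval_unique φ, MvPolynomial.aeval_monomial, Algebra.smul_def,
          Finsupp.prod_fintype _ _ fun _ => pow_zero _]
        rfl
      rw [h]
      exact Submodule.smul_mem _ _ (hbB _ _ fun i => Finsupp.le_degree i a)
    | add p q hp hq =>
      obtain ⟨m, hm⟩ := hp
      obtain ⟨n, hn⟩ := hq
      rw [map_add]
      exact ⟨max m n, add_mem (hBmono (le_max_left _ _) hm) (hBmono (le_max_right _ _) hn)⟩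
  have hbli : ∀ n, LinearIndependent k (b n) := by
    intro n
    have h := ((MvPolynomial.basisMonomials (Fin s) k).linearIndependent.map'
      φ.toLinearMap (LinearMap.ker_eq_bot.2 hinj)).comp
      (fun a : Fin s → Fin (n + 1) => Finsupp.equivFunOnFinite.symm fun i => (a i : ℕ))
      (fun a a' h => by
        funext i
        have := congrFun (Finsupp.equivFunOnFinite.symm.injective h) i
        exact Fin.ext this)
    convert! h using 1
    funext a
    simp only [Function.comp_apply, MvPolynomial.coe_basisMonomials, AlgHom.toLinearMap_apply]
    rw [MvPolynomial.aeval_unique φ, MvPolynomial.aeval_monomial, map_one, one_mul,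
      Finsupp.prod_fintype _ _ fun _ => pow_zero _]
    rfl
  have hBrank : ∀ n, Module.finrank k (B n) = (n + 1) ^ s := fun n => by
    rw [finrank_span_eq_card (hbli n)]
    simp
  have hVfd : ∀ n, FiniteDimensional k ↥(V ^ n) := fun n =>
    Module.Finite.iff_fg.2 ((Module.Finite.iff_fg.1 inferInstance : V.FG).pow n)
  -- Lower bound: the `y i` all lie in one power of `V`.
  obtain ⟨c₀, hc₀⟩ : ∃ c₀, ∀ i, y i ∈ V ^ c₀ := by
    choose e he using fun i => hV (y i)
    exact ⟨Finset.univ.sup e, fun i => hmono (Finset.le_sup (f := e) (Finset.mem_univ i)) (he i)⟩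
  have hBV : ∀ n, B n ≤ V ^ (c₀ * s * n) := by
    intro n
    rw [Submodule.span_le]
    rintro _ ⟨a, rfl⟩
    have h : ∏ i, y i ^ (a i : ℕ) ∈ V ^ ∑ i, c₀ * (a i : ℕ) := by
      induction (Finset.univ : Finset (Fin s)) using Finset.induction_on with
      | empty => simp [Submodule.one_le.1 le_rfl]
      | insert j u hj ih =>
        rw [Finset.prod_insert hj, Finset.sum_insert hj, pow_add, pow_mul]
        exact Submodule.mul_mem_mul (Submodule.pow_mem_pow _ (hc₀ j) _) ih
    refine hmono ?_ h
    rw [← Finset.mul_sum, mul_assoc]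
    refine Nat.mul_le_mul_left _ ?_
    refine (Finset.sum_le_card_nsmul _ _ n fun i _ => Nat.le_of_lt_succ (a i).2).trans ?_
    simp
  -- Upper bound: `A` is a finite module over the polynomial ring generated by the `y i`.
  algebraize [φ.toRingHom]
  have hAfin : Module.Finite (MvPolynomial (Fin s) k) A := hfin
  obtain ⟨S₀, hS₀⟩ := hAfin.fg_top
  let S : Finset A := insert 1 S₀
  let M : Submodule k A := Submodule.span k (S : Set A)
  have h1M : (1 : A) ∈ M := Submodule.subset_span (by simp [S])
  have hall : ∀ a, ∃ n, a ∈ B n * M := by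
    intro a
    have ha : a ∈ Submodule.span (MvPolynomial (Fin s) k) (S₀ : Set A) := by
      rw [hS₀]
      trivial
    refine Submodule.span_induction (p := fun a _ => ∃ n, a ∈ B n * M) ?_ ?_ ?_ ?_ ha
    · intro a ha
      refine ⟨0, ?_⟩
      rw [← one_mul a]
      refine Submodule.mul_mem_mul ?_ (Submodule.subset_span (by simp [S, ha]))
      simpa using hbB 0 0 (fun i => le_rfl)
    · exact ⟨0, zero_mem _⟩
    · rintro a a' _ _ ⟨m, hm⟩ ⟨n, hn⟩
      exact ⟨max m n, add_mem (mul_le_mul_left (hBmono (le_max_left _ _)) _ hm)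
        (mul_le_mul_left (hBmono (le_max_right _ _)) _ hn)⟩
    · rintro p a _ ⟨n, hn⟩
      obtain ⟨m, hm⟩ := hBall p
      refine ⟨m + n, mul_le_mul_left (hBmul m n) _ ?_⟩
      rw [mul_assoc]
      exact Submodule.mul_mem_mul hm hn
  obtain ⟨c₁, hc₁⟩ : ∃ c₁, V * M ≤ B c₁ * M := by
    have hfg : (V * M).FG := Submodule.FG.mul ⟨t, ht⟩ ⟨S, rfl⟩
    obtain ⟨T, hT⟩ := hfg
    choose e he using hall
    refine ⟨T.sup e, ?_⟩
    rw [← hT, Submodule.span_le]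
    intro a ha
    exact mul_le_mul_left (hBmono (Finset.le_sup (f := e) ha)) _ (he a)
  have hVB : ∀ n, V ^ n * M ≤ B (c₁ * n) * M := by
    intro n
    induction n with
    | zero =>
      refine mul_le_mul_left ?_ _
      rw [pow_zero, Submodule.one_le]
      simpa using hbB (c₁ * 0) 0 (fun i => Nat.zero_le _)
    | succ n ih =>
      calc V ^ (n + 1) * M = V * (V ^ n * M) := by rw [pow_succ', mul_assoc]
        _ ≤ V * (B (c₁ * n) * M) := mul_le_mul_right ih _
        _ = B (c₁ * n) * (V * M) := by ring
        _ ≤ B (c₁ * n) * (B c₁ * M) := mul_le_mul_right hc₁ _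
        _ = B (c₁ * n) * B c₁ * M := by ring
        _ ≤ B (c₁ * (n + 1)) * M := mul_le_mul_left (hBmul _ _) _
  have hBM : ∀ n, Module.finrank k ↥(B n * M) ≤ S.card * (n + 1) ^ s := by
    intro n
    have h : B n * M = Submodule.span k
        (Set.range fun p : S × (Fin s → Fin (n + 1)) => b n p.2 * p.1) := by
      rw [Submodule.span_mul_span]
      congr 1
      ext a
      constructor
      · rintro ⟨_, ⟨a, rfl⟩, e, he, rfl⟩
        exact ⟨(⟨e, he⟩, a), rfl⟩
      · rintro ⟨⟨e, a⟩, rfl⟩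
        exact ⟨_, ⟨a, rfl⟩, e, e.2, rfl⟩
    rw [h]
    refine (finrank_range_le_card _).trans ?_
    simp
  refine ⟨s, c₀ * s + c₁, S.card, ?_, fun n => ?_, fun n => ?_⟩
  · have : Algebra.IsIntegral (MvPolynomial (Fin s) k) A := inferInstance
    rw [← ringKrullDim_eq_of_isIntegral_of_injective (R := MvPolynomial (Fin s) k) (S := A) hinj,
      MvPolynomial.ringKrullDim_of_isNoetherianRing, ringKrullDim_eq_zero_of_field]
    simp
  · rw [← hBrank]
    have := hVfd ((c₀ * s + c₁) * n)
    exact Submodule.finrank_mono ((hBV n).trans (hmono (Nat.mul_le_mul_right n (by omega))))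
  · have hle : V ^ n ≤ B (c₁ * n) * M := by
      refine le_trans ?_ (hVB n)
      calc V ^ n = V ^ n * 1 := (mul_one _).symm
        _ ≤ V ^ n * M := mul_le_mul_right (Submodule.one_le.2 h1M) _
    have : FiniteDimensional k ↥(B (c₁ * n) * M) :=
      Module.Finite.iff_fg.2 (Submodule.FG.mul (Submodule.fg_span (Set.finite_range _)) ⟨S, rfl⟩)
    refine (Submodule.finrank_mono hle).trans ((hBM _).trans ?_)
    refine Nat.mul_le_mul_left _ (Nat.pow_le_pow_left ?_ s)
    gcongr
    · omega
    · omega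

end Growth

/-! ### The associated graded ring -/

section AssociatedGradedRing

variable {R : Type u} [CommRing R]

/-- The homogeneous element of degree `n` of the associated graded ring given by `a ∈ I ^ n`. -/
def initialForm (I : Ideal R) (n : ℕ) : (I ^ n : Ideal R) →ₗ[R] AssociatedGradedRing I :=
  DirectSum.lof R ℕ (GrPiece I) n ∘ₗ GrPiece.mk I n

theorem initialForm_mul (I : Ideal R) {i j : ℕ} (a : (I ^ i : Ideal R)) (b : (I ^ j : Ideal R)) :
    initialForm I i a * initialForm I j b =
      initialForm I (i + j) ⟨(a : R) * (b : R), GrPiece.mul_mem I a.2 b.2⟩ :=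
  DirectSum.of_mul_of (A := GrPiece I) _ _

theorem initialForm_congr (I : Ideal R) {i j : ℕ} (h : i = j) (a : (I ^ i : Ideal R))
    (b : (I ^ j : Ideal R)) (hab : (a : R) = b) : initialForm I i a = initialForm I j b :=
  DirectSum.of_eq_of_gradedMonoid_eq (GrPiece.gradedMk_eq I h a b hab)

theorem initialForm_apply_of_ne (I : Ideal R) {i j : ℕ} (h : i ≠ j) (a : (I ^ i : Ideal R)) :
    initialForm I i a j = 0 :=
  DirectSum.of_eq_of_ne _ _ _ h.symm

theorem exists_initialForm_sum (I : Ideal R) (g : AssociatedGradedRing I) :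
    ∃ a : ∀ i, (I ^ i : Ideal R), (∀ i, GrPiece.mk I i (a i) = g i) ∧
      ∀ s : Finset ℕ, (∀ i ∉ s, g i = 0) → ∑ i ∈ s, initialForm I i (a i) = g := by
  classical
  choose a ha using fun i => GrPiece.mk_surjective I i (g i)
  refine ⟨a, ha, fun s hs => ?_⟩
  have h1 : ∀ i, initialForm I i (a i) = DirectSum.of (GrPiece I) i (g i) := fun i => by
    rw [← ha i]
    rfl
  simp only [h1]
  refine Eq.trans (Finset.sum_subset ?_ fun i _ hi => ?_).symm (DirectSum.sum_support_of g)
  · intro i hi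
    by_contra h
    exact (DFinsupp.mem_support_iff.1 hi) (hs i h)
  · rw [DFinsupp.notMem_support_iff.1 hi, map_zero]

/-- The ring homomorphism `R → gr_I R` onto the part of degree zero. -/
def degreeZeroHom (I : Ideal R) : R →+* AssociatedGradedRing I where
  toFun r := initialForm I 0 ⟨r, by simp⟩
  map_one' := rfl
  map_mul' r s := by
    rw [initialForm_mul]
  map_zero' := map_zero (initialForm I 0)
  map_add' r s := map_add (initialForm I 0) ⟨r, by simp⟩ ⟨s, by simp⟩

theorem degreeZeroHom_mul (I : Ideal R) (r : R) (g : AssociatedGradedRing I) :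
    degreeZeroHom I r * g = r • g := by
  obtain ⟨a, ha, hg⟩ := exists_initialForm_sum I g
  classical
  rw [← hg (DFinsupp.support g) fun i hi => DFinsupp.notMem_support_iff.1 hi, Finset.mul_sum,
    Finset.smul_sum]
  refine Finset.sum_congr rfl fun i _ => ?_
  refine (initialForm_mul I _ _).trans ?_
  rw [← map_smul]
  exact initialForm_congr I (Nat.zero_add i) _ _ rfl

theorem degreeZeroHom_eq_zero (I : Ideal R) {r : R} (hr : r ∈ I) : degreeZeroHom I r = 0 := by
  refine (congrArg (DirectSum.of (GrPiece I) 0) ?_).trans (map_zero _)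
  exact (GrPiece.mk_eq_zero_iff I 0 _).2 (by simpa using hr)

theorem length_quotient_pow_succ_eq_add (I : Ideal R) (n : ℕ) :
    Module.length R (R ⧸ I ^ (n + 1)) =
      Module.length R (GrPiece I n) + Module.length R (R ⧸ I ^ n) := by
  let f : GrPiece I n →ₗ[R] R ⧸ I ^ (n + 1) :=
    Submodule.mapQ (Submodule.submoduleOf (I ^ (n + 1)) (I ^ n)) (I ^ (n + 1))
      (I ^ n : Ideal R).subtype le_rfl
  refine Module.length_eq_add_of_exact f
    (Submodule.factor (Ideal.pow_le_pow_right (Nat.le_succ n))) ?_ (Submodule.factor_surjective _) ?_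
  · rw [← LinearMap.ker_eq_bot, LinearMap.ker_eq_bot']
    intro a ha
    obtain ⟨a, rfl⟩ := GrPiece.mk_surjective I n a
    exact (GrPiece.mk_eq_zero_iff I n a).2 ((Submodule.Quotient.mk_eq_zero _).1 ha)
  · intro b
    obtain ⟨b, rfl⟩ := Submodule.mkQ_surjective _ b
    constructor
    · intro hb
      exact ⟨GrPiece.mk I n ⟨b, (Submodule.Quotient.mk_eq_zero _).1 hb⟩, rfl⟩
    · rintro ⟨a, ha⟩
      obtain ⟨a, rfl⟩ := GrPiece.mk_surjective I n a
      rw [← ha]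
      exact (Submodule.Quotient.mk_eq_zero _).2 a.2

theorem sum_length_grPiece (I : Ideal R) (n : ℕ) :
    ∑ i ∈ Finset.range n, Module.length R (GrPiece I i) = Module.length R (R ⧸ I ^ n) := by
  induction n with
  | zero =>
    have : Subsingleton (R ⧸ I ^ 0) := by
      rw [pow_zero, Ideal.one_eq_top]
      exact Ideal.Quotient.subsingleton_iff.2 rfl
    rw [Finset.sum_range_zero, Module.length_eq_zero]
  | succ n ih =>
    rw [Finset.sum_range_succ, ih, length_quotient_pow_succ_eq_add, add_comm]

section Local

variable [IsLocalRing R]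

variable (R) in
/-- The associated graded ring of a local ring is an algebra over the residue field. -/
noncomputable instance instAlgebraAssociatedGradedRing :
    Algebra (ResidueField R) (AssociatedGradedRing (maximalIdeal R)) :=
  (Ideal.Quotient.lift (maximalIdeal R) (degreeZeroHom (maximalIdeal R))
    fun _ hr => degreeZeroHom_eq_zero _ hr : ResidueField R →+* _).toAlgebra

theorem residue_smul_eq (r : R) (g : AssociatedGradedRing (maximalIdeal R)) :
    residue R r • g = r • g := by
  rw [← degreeZeroHom_mul, Algebra.smul_def]
  rfl

instance : IsScalarTower R (ResidueField R) (AssociatedGradedRing (maximalIdeal R)) :=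
  IsScalarTower.of_algebraMap_smul residue_smul_eq

variable (R) in
/-- The elements of degree at most `n` of the associated graded ring of a local ring. -/
noncomputable def gradedDegreeLE (n : ℕ) :
    Submodule (ResidueField R) (AssociatedGradedRing (maximalIdeal R)) where
  carrier := {g | ∀ i, n < i → g i = 0}
  zero_mem' _ _ := rfl
  add_mem' {g h} hg hh i hi := by
    rw [DirectSum.add_apply, hg i hi, hh i hi, add_zero]
  smul_mem' c g hg i hi := by
    obtain ⟨r, rfl⟩ := residue_surjective c
    rw [residue_smul_eq, DirectSum.smul_apply, hg i hi, smul_zero]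

theorem initialForm_mem_gradedDegreeLE {i n : ℕ} (h : i ≤ n) (a : (maximalIdeal R ^ i : Ideal R)) :
    initialForm (maximalIdeal R) i a ∈ gradedDegreeLE R n := fun j hj =>
  initialForm_apply_of_ne _ (by omega) a

theorem exists_initialForm_sum_of_mem_gradedDegreeLE {n : ℕ}
    {g : AssociatedGradedRing (maximalIdeal R)} (hg : g ∈ gradedDegreeLE R n) :
    ∃ a : ∀ i, (maximalIdeal R ^ i : Ideal R),
      g = ∑ i ∈ Finset.range (n + 1), initialForm (maximalIdeal R) i (a i) := by
  obtain ⟨a, -, ha⟩ := exists_initialForm_sum _ g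
  refine ⟨a, (ha _ fun i hi => hg i ?_).symm⟩
  rw [Finset.mem_range] at hi
  omega

theorem one_mem_gradedDegreeLE (n : ℕ) : 1 ∈ gradedDegreeLE R n :=
  initialForm_mem_gradedDegreeLE (Nat.zero_le n) ⟨1, by simp⟩

/-- The associated graded ring is generated in degree one: the powers of the space of elements of
degree at most one are the spaces of elements of bounded degree. -/
theorem gradedDegreeLE_one_pow (n : ℕ) : gradedDegreeLE R 1 ^ n = gradedDegreeLE R n := by
  apply le_antisymm
  · induction n with
    | zero =>
      rw [pow_zero, Submodule.one_le]
      exact one_mem_gradedDegreeLE 0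
    | succ n ih =>
      rw [pow_succ, Submodule.mul_le]
      intro g hg h hh
      obtain ⟨a, rfl⟩ := exists_initialForm_sum_of_mem_gradedDegreeLE (ih hg)
      obtain ⟨b, rfl⟩ := exists_initialForm_sum_of_mem_gradedDegreeLE hh
      rw [Finset.sum_mul_sum]
      refine Submodule.sum_mem _ fun i hi => Submodule.sum_mem _ fun j hj => ?_
      rw [initialForm_mul]
      rw [Finset.mem_range] at hi hj
      exact initialForm_mem_gradedDegreeLE (by omega) _
  · have hpiece : ∀ i (a : (maximalIdeal R ^ i : Ideal R)),
        initialForm (maximalIdeal R) i a ∈ gradedDegreeLE R 1 ^ i := by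
      intro i
      induction i with
      | zero =>
        rintro ⟨a, ha⟩
        rw [pow_zero]
        exact Submodule.mem_one.2 ⟨residue R a, rfl⟩
      | succ i ih =>
        rintro ⟨a, ha⟩
        have h : ∃ h : a ∈ maximalIdeal R ^ (i + 1),
            initialForm (maximalIdeal R) (i + 1) ⟨a, h⟩ ∈ gradedDegreeLE R 1 ^ (i + 1) := by
          have ha' : a ∈ maximalIdeal R ^ i * maximalIdeal R := by rwa [← pow_succ]
          refine Submodule.mul_induction_on ha' ?_ ?_
          · intro b hb c hc
            have hc' : c ∈ maximalIdeal R ^ 1 := by rwa [pow_one]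
            refine ⟨GrPiece.mul_mem _ hb hc', ?_⟩
            have h := Submodule.mul_mem_mul (ih ⟨b, hb⟩)
              (initialForm_mem_gradedDegreeLE (R := R) le_rfl ⟨c, hc'⟩)
            rw [initialForm_mul] at h
            rw [pow_succ]
            exact h
          · rintro b c ⟨hb, hb'⟩ ⟨hc, hc'⟩
            refine ⟨add_mem hb hc, ?_⟩
            have h := add_mem hb' hc'
            rw [← map_add] at h
            exact h
        exact h.2
    intro g hg
    obtain ⟨a, rfl⟩ := exists_initialForm_sum_of_mem_gradedDegreeLE hg
    refine Submodule.sum_mem _ fun i hi => ?_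
    rw [Finset.mem_range] at hi
    exact pow_le_pow_right' (Submodule.one_le.2 (one_mem_gradedDegreeLE 1))
      (Nat.lt_succ_iff.1 hi) (hpiece i (a i))

theorem exists_mem_gradedDegreeLE (g : AssociatedGradedRing (maximalIdeal R)) :
    ∃ n, g ∈ gradedDegreeLE R n := by
  classical
  refine ⟨(DFinsupp.support g).sup id, fun i hi => ?_⟩
  by_contra h
  exact hi.not_ge (Finset.le_sup (f := id) (DFinsupp.mem_support_iff.2 h))

theorem length_gradedDegreeLE (n : ℕ) :
    Module.length (ResidueField R) (gradedDegreeLE R n) =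
      Module.length R (R ⧸ maximalIdeal R ^ (n + 1)) := by
  classical
  let f : gradedDegreeLE R n →ₗ[R] ∀ i : Fin (n + 1), GrPiece (maximalIdeal R) i :=
    { toFun g i := g.1 i
      map_add' g h := rfl
      map_smul' r g := rfl }
  have hf : Function.Bijective f := by
    constructor
    · intro g h hgh
      refine Subtype.ext (DFinsupp.ext fun i => ?_)
      by_cases hi : i < n + 1
      · exact congrFun hgh ⟨i, hi⟩
      · rw [g.2 i (by omega), h.2 i (by omega)]
    · intro p
      refine ⟨⟨∑ i : Fin (n + 1), DirectSum.of (GrPiece (maximalIdeal R)) i (p i), ?_⟩, ?_⟩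
      · refine Submodule.sum_mem _ fun i _ => ?_
        obtain ⟨a, ha⟩ := GrPiece.mk_surjective _ _ (p i)
        rw [← ha]
        exact initialForm_mem_gradedDegreeLE (Nat.lt_succ_iff.1 i.2) a
      · funext j
        change (∑ i : Fin (n + 1), DirectSum.of (GrPiece (maximalIdeal R)) i (p i)) (j : ℕ) = p j
        rw [DFinsupp.finsetSum_apply, Finset.sum_eq_single j]
        · exact DirectSum.of_eq_same _ _
        · exact fun i _ hij => DirectSum.of_eq_of_ne _ _ _ fun h => hij (Fin.ext h).symm
        · simp
  rw [← Module.length_eq_of_surjective (S := R) (R := ResidueField R) residue_surjective,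
    (LinearEquiv.ofBijective f hf).length_eq, Module.length_pi_of_fintype,
    ← sum_length_grPiece, Finset.sum_range]

instance : Nontrivial (AssociatedGradedRing (maximalIdeal R)) := by
  refine ⟨1, 0, fun h => ?_⟩
  have h0 : GrPiece.ofDegreeZero (maximalIdeal R) 1 = 0 :=
    (DirectSum.of_injective (β := GrPiece (maximalIdeal R)) 0) (h.trans (map_zero _).symm)
  have h1 := (GrPiece.mk_eq_zero_iff _ _ _).1 h0
  rw [zero_add, pow_one] at h1
  exact (Ideal.ne_top_iff_one _).1 (maximalIdeal.isMaximal R).ne_top h1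

theorem finiteDimensional_gradedDegreeLE (hR : (maximalIdeal R).FG) (n : ℕ) :
    FiniteDimensional (ResidueField R) (gradedDegreeLE R n) := by
  have h : Module.length (ResidueField R) (gradedDegreeLE R n) ≠ ⊤ := by
    rw [length_gradedDegreeLE]
    exact length_quotient_pow_ne_top hR _
  have := (isFiniteLength_iff_isNoetherian_isArtinian.1 (Module.length_ne_top_iff.1 h)).1
  infer_instance

theorem finrank_gradedDegreeLE (hR : (maximalIdeal R).FG) (n : ℕ) :
    Module.finrank (ResidueField R) (gradedDegreeLE R n) = hilbertSamuel R (n + 1) := by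
  have := finiteDimensional_gradedDegreeLE hR n
  rw [hilbertSamuel, ← length_gradedDegreeLE, Module.length_eq_finrank, ENat.toNat_natCast]

/-- The Krull dimension of the associated graded ring is the degree of the Hilbert–Samuel
polynomial, since both measure the growth of the space of elements of degree at most `n`. -/
theorem ringKrullDim_associatedGradedRing (hR : (maximalIdeal R).FG) {P : ℚ[X]}
    (hP : IsHilbertSamuelPolynomial R P) :
    ringKrullDim (AssociatedGradedRing (maximalIdeal R)) = P.natDegree := by
  have := finiteDimensional_gradedDegreeLE hR 1
  obtain ⟨s, c, r, hdim, hlow, hup⟩ := exists_ringKrullDim_eq_and_finrank_pow_bounds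
    (gradedDegreeLE R 1) (one_mem_gradedDegreeLE 1) fun g => by
      simp only [gradedDegreeLE_one_pow]
      exact exists_mem_gradedDegreeLE g
  have hrank : ∀ n, Module.finrank (ResidueField R) ↥(gradedDegreeLE R 1 ^ n) =
      hilbertSamuel R (n + 1) := fun n => by
    rw [gradedDegreeLE_one_pow, finrank_gradedDegreeLE hR]
  simp only [hrank] at hlow hup
  have hPe := (isHilbertSamuelPolynomial_iff hR P).1 hP
  rw [hdim, Nat.cast_inj]
  have hpow : ((C 1 * X + C 1 : ℚ[X]) ^ s).degree = (s : WithBot ℕ) := by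
    rw [degree_pow, degree_linear one_ne_zero, nsmul_eq_mul, mul_one]
  apply le_antisymm
  · have hmono := monotone_hilbertSamuel hR
    have h : ((C 1 * X + C 1) ^ s : ℚ[X]).degree ≤ (P.comp (C ((c : ℚ) + 1) * X + C 1)).degree := by
      refine degree_le_of_eventually_le ?_
      have ht : Tendsto (fun n => (c + 1) * n + 1) atTop atTop :=
        tendsto_atTop_mono
          (fun n => (Nat.le_mul_of_pos_left n (Nat.succ_pos c)).trans (Nat.le_succ _)) tendsto_id
      filter_upwards [ht.eventually hPe] with n hn
      push_cast at hn
      simp only [eval_comp, eval_pow, eval_add, eval_mul, eval_C, eval_X, hn, one_mul]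
      refine ⟨by positivity, ?_⟩
      exact_mod_cast (hlow n).trans (hmono (by nlinarith))
    rw [hpow] at h
    have h2 := le_natDegree_of_coe_le_degree h
    rwa [natDegree_comp, natDegree_linear (by positivity), mul_one] at h2
  · have h : P.degree ≤ (C (r : ℚ) * (C (c : ℚ) * X + C 1) ^ s).degree := by
      refine degree_le_of_eventually_le ?_
      filter_upwards [hPe, eventually_gt_atTop 0] with n hn hn0
      simp only [eval_pow, eval_add, eval_mul, eval_C, eval_X, hn]
      refine ⟨Nat.cast_nonneg _, ?_⟩
      obtain ⟨m, rfl⟩ := Nat.exists_eq_succ_of_ne_zero hn0.ne'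
      exact_mod_cast hup m
    calc P.natDegree ≤ _ := natDegree_le_natDegree h
      _ ≤ ((C (c : ℚ) * X + C 1) ^ s).natDegree := natDegree_C_mul_le _ _
      _ ≤ s * (C (c : ℚ) * X + C 1).natDegree := natDegree_pow_le
      _ ≤ s * 1 := Nat.mul_le_mul_left s natDegree_linear_le
      _ = s := mul_one s

end Local

end AssociatedGradedRing

theorem theorem3p5 (R : Type u) [CommRing R] [IsLocalRing R]
    (hR : (IsLocalRing.maximalIdeal R).FG) :
    ∃ d : ℕ,
      pseudoDim R = (d : ℕ∞) ∧
      IsLeast {n : ℕ | HasPrimaryIdealGeneratedBy R n} d ∧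
      ringKrullDim (AdicCompletion (IsLocalRing.maximalIdeal R) R) = (d : WithBot ℕ∞) ∧
      ringKrullDim (AssociatedGradedRing (IsLocalRing.maximalIdeal R)) = (d : WithBot ℕ∞) ∧
      (∃ P : Polynomial ℚ, IsHilbertSamuelPolynomial R P ∧
        (∀ Q : Polynomial ℚ, IsHilbertSamuelPolynomial R Q → Q = P) ∧
        P.degree = (d : WithBot ℕ)) ∧
      pseudoDim (SeparatedQuotientRing R) = (d : ℕ∞) := by
  classical
  have hex := exists_hasPrimaryIdealGeneratedBy hR
  let d := Nat.find hex
  have hd : IsLeast {n : ℕ | HasPrimaryIdealGeneratedBy R n} d :=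
    ⟨Nat.find_spec hex, fun n hn => Nat.find_min' hex hn⟩
  obtain ⟨P, hP⟩ := exists_isHilbertSamuelPolynomial hR
  have hPe := (isHilbertSamuelPolynomial_iff hR P).1 hP
  have := AdicCompletion.isLocalRing_of_fg hR
  have := isNoetherianRing_adicCompletion hR
  have hcompl := inducesIsoOnPowerQuotients_adicCompletion hR
  have hdimcompl : ringKrullDim (AdicCompletion (maximalIdeal R) R) = (d : WithBot ℕ∞) := by
    refine ringKrullDim_eq_of_isLeast ?_
    simpa only [← hcompl.hasPrimaryIdealGeneratedBy_iff hR] using hd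
  have hPd : P.natDegree = d := by
    apply le_antisymm
    · exact hP.natDegree_le_of_pseudoDimLE hR
        ((pseudoDimLE_iff_hasPrimaryIdealGeneratedBy hR d).2 hd.1)
    · have hP' : IsHilbertSamuelPolynomial (AdicCompletion (maximalIdeal R) R) P := by
        rw [isHilbertSamuelPolynomial_iff (hcompl.fg hR)]
        simpa only [← hcompl.hilbertSamuel_eq] using hPe
      exact hP'.le_natDegree_of_le_ringKrullDim hdimcompl.ge
  refine ⟨d, pseudoDim_eq_of_isLeast hR hd, hd, hdimcompl, ?_, ⟨P, hP, fun Q hQ => ?_, ?_⟩, ?_⟩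
  · rw [ringKrullDim_associatedGradedRing hR hP, hPd]
  · refine eq_of_eventually_eval_eq ?_
    filter_upwards [hPe, (isHilbertSamuelPolynomial_iff hR Q).1 hQ] with n h1 h2
    rw [h1, h2]
  · rw [degree_eq_natDegree (hP.ne_zero hR), hPd]
  · have := isLocalRing_separatedQuotientRing (R := R)
    have hsep := inducesIsoOnPowerQuotients_separatedQuotientRing (R := R)
    refine pseudoDim_eq_of_isLeast (hsep.fg hR) ?_
    simpa only [← hsep.hasPrimaryIdealGeneratedBy_iff hR] using hd
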